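/- Let $\mathbb T=[0,1)$ and $1\le p<\infty$. Let $L_p(\mathbb T)$ be the space of measurable, everywhere finite (real- or complex-valued) $1$-periodic functions $f$ with $\|f\|_p=\big(\int_0^1|f(x)|^p\,dx\big)^{1/p}<\infty$; functions that agree almost everywhere are \emph{not} identified. For $s\in\mathbb N=\{1,2,\dots\}$, let $W_p^s(\mathbb T)$ be the set of $1$-periodic $f$ such that $f^{(s-1)}$ is absolutely continuous and $f^{(s)}\in L_p(\mathbb T)$, and let $$\omega_s(f,\delta)_p=\sup_{0<h<\delta}\|\Delta_h^s f\|_p,\qquad \Delta_h^sf(x)=\sum_{\nu=0}^s\binom s\nu(-1)^\nu f(x+(s-\nu)h),\qquad \delta>0.$$ For $r\in\mathbb N$ and $\delta>0$ let $$f_{\delta,r}(x)=(-1)^{r+1}\binom{2r}{r}^{-1}\frac2\delta\int_{-\delta/2}^{\delta/2}\sum_{\nu=0}^{r-1}(-1)^\nu\binom{2r}{\nu}f\Big(x+\frac{r-\nu}{r}t\Big)\,dt.$$ Let $\gamma\in(0,1]$ and, for every $n\in\mathbb N$, let $X_n=(x_{k,n})_{k=1}^n$ satisfy $0\le x_{1,n}<\dots<x_{n,n}<1$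 and $\min_{1\le k\le n}(x_{k+1,n}-x_{k,n})\ge\gamma/n$, where $x_{n+1,n}=1+x_{1,n}$. Put $\|f\|_{\ell_p(X_n)}=\big(\frac1n\sum_{k=1}^n|f(x_{k,n})|^p\big)^{1/p}$, and let $G_n(f)=\sum_{k=1}^nf(x_{k,n})\varphi_{k,n}$ with functions $\varphi_{k,n}\in L_p(\mathbb T)$. Let $r,s\in\mathbb N$, $s\le 2r$, and suppose that for some constants $K_1,K_3>0$ $$\|G_n(f)\|_p\le K_1\|f\|_{\ell_p(X_n)}\quad\text{for all } f\in L_p(\mathbb T),\ n\in\mathbb N,$$ $$\|f-G_n(f)\|_p\le K_3n^{-s}\|f^{(s)}\|_p\quad\text{for all } f\in W_p^s(\mathbb T),\ n\in\mathbb N.$$ Then, for all $f\in L_p(\mathbb T)$ and $n\in\mathbb N$, $$\|f-G_n(f)\|_p\le K_1\|f_{\gamma/n,r}-f\|_{\ell_p(X_n)}+C_1\,\omega_s(f,1/n)_p.$$ If, additionally, for some constant $K_2>0$, $$K_2\|f\|_{\ell_p(X_n)}\le\|G_n(f)\|_p\quad\text{for all } f\in L_p(\mathbb T),\ n\in\mathbb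 N,$$ then, for all $f\in L_p(\mathbb T)$ and $n\in\mathbb N$, $$K_2\|f_{\gamma/n,r}-f\|_{\ell_p(X_n)}-C_2\,\omega_s(f,1/n)_p\le\|f-G_n(f)\|_p.$$ Here $C_1$ and $C_2$ are positive constants independent of $f$ and $n$; more precisely, they depend only on $p,r,s,\gamma,K_1,K_3$. -/

import Mathlib

open MeasureTheory

namespace SamplingLp

noncomputable section

/-- The space `L_p(𝕋)`, `𝕋 = [0,1)`: functions `ℝ → 𝕜`, given by their values at every point (there is no
identification of functions that agree almost everywhere), that are `1`-periodic, Lebesgue measurable and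
satisfy `∫₀¹ |f|^p < ∞`. -/
def MemLpT {𝕜 : Type*} [RCLike 𝕜] (p : ℝ) (f : ℝ → 𝕜) : Prop :=
  Function.Periodic f 1 ∧ MemLp f (ENNReal.ofReal p) (volume.restrict (Set.Ico (0 : ℝ) 1))

/-- The norm `‖f‖_p = (∫₀¹ |f(x)|^p dx)^{1/p}`. -/
def normT {𝕜 : Type*} [RCLike 𝕜] (p : ℝ) (f : ℝ → 𝕜) : ℝ :=
  (∫ x in Set.Ico (0 : ℝ) 1, ‖f x‖ ^ p) ^ (1 / p)

/-- The discrete semi-norm `‖f‖_{ℓ_p(X_n)} = ((1/n) ∑_{k=1}^n |f(x_k)|^p)^{1/p}`, where the points of `X_n`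
are `y 1, …, y n`. -/
def discNorm {𝕜 : Type*} [RCLike 𝕜] (p : ℝ) (n : ℕ) (y : ℕ → ℝ) (f : ℝ → 𝕜) : ℝ :=
  ((1 / (n : ℝ)) * ∑ k ∈ Finset.Icc 1 n, ‖f (y k)‖ ^ p) ^ (1 / p)

/-- The difference `Δ_h^r f(x) = ∑_{ν=0}^r C(r,ν) (-1)^ν f(x + (r-ν)h)`. -/
def diff {𝕜 : Type*} [RCLike 𝕜] (r : ℕ) (h : ℝ) (f : ℝ → 𝕜) (x : ℝ) : 𝕜 :=
  ∑ ν ∈ Finset.range (r + 1), (r.choose ν : 𝕜) * (-1) ^ ν * f (x + ((r : ℝ) - (ν : ℝ)) * h)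

/-- The modulus of smoothness `ω_r(f,δ)_p = sup_{0<h<δ} ‖Δ_h^r f‖_p`. -/
def modulus {𝕜 : Type*} [RCLike 𝕜] (p : ℝ) (r : ℕ) (f : ℝ → 𝕜) (δ : ℝ) : ℝ :=
  sSup ((fun h : ℝ => normT p (diff r h f)) '' Set.Ioo 0 δ)

/-- The generalized Steklov average
`f_{δ,r}(x) = (-1)^{r+1} C(2r,r)⁻¹ (2/δ) ∫_{-δ/2}^{δ/2} ∑_{ν=0}^{r-1} (-1)^ν C(2r,ν) f(x + ((r-ν)/r) t) dt`. -/
def steklov {𝕜 : Type*} [RCLike 𝕜] (δ : ℝ) (r : ℕ) (f : ℝ → 𝕜) (x : ℝ) : 𝕜 :=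
  (-1) ^ (r + 1) * (((2 * r).choose r : ℕ) : 𝕜)⁻¹ * ((2 / δ : ℝ) : 𝕜) *
    ∫ t in (-(δ / 2))..(δ / 2), ∑ ν ∈ Finset.range r,
      (-1) ^ ν * (((2 * r).choose ν : ℕ) : 𝕜) * f (x + (((r : ℝ) - (ν : ℝ)) / (r : ℝ)) * t)

/-- The Sobolev class `W_p^s(𝕋)`, for `s ≥ 1`: `f` is `1`-periodic, `f^{(s-1)}` exists and is absolutely
continuous, and `f^{(s)}` (which then exists almost everywhere) belongs to `L_p(𝕋)`. -/
def MemSobolevT {𝕜 : Type*} [RCLike 𝕜] (p : ℝ) (s : ℕ) (f : ℝ → 𝕜) : Prop :=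
  Function.Periodic f 1 ∧ ContDiff ℝ ((s - 1 : ℕ) : ℕ∞) f ∧
    AbsolutelyContinuousOnInterval (iteratedDeriv (s - 1) f) 0 1 ∧ MemLpT p (iteratedDeriv s f)

/-- A node system: `x n 1, …, x n n` are the points of `X_n` and `x n (n + 1) = 1 + x n 1`; consecutive
points are at a distance at least `γ / n`. -/
structure IsNodeSystem (γ : ℝ) (x : ℕ → ℕ → ℝ) : Prop where
  nonneg : ∀ n : ℕ, 1 ≤ n → 0 ≤ x n 1
  lt_succ : ∀ n k : ℕ, 1 ≤ k → k < n → x n k < x n (k + 1)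
  lt_one : ∀ n : ℕ, 1 ≤ n → x n n < 1
  wrap : ∀ n : ℕ, 1 ≤ n → x n (n + 1) = 1 + x n 1
  separated : ∀ n k : ℕ, 1 ≤ k → k ≤ n → γ / (n : ℝ) ≤ x n (k + 1) - x n k

/-- The sampling operator `G_n(f)(t) = ∑_{k=1}^n f(x_{k,n}) φ_{k,n}(t)`. -/
def sampling {𝕜 : Type*} [RCLike 𝕜] (x : ℕ → ℕ → ℝ) (φ : ℕ → ℕ → ℝ → 𝕜) (n : ℕ) (f : ℝ → 𝕜)
    (t : ℝ) : 𝕜 :=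
  ∑ k ∈ Finset.Icc 1 n, f (x n k) * φ n k t

/-- `‖G_n(f)‖_p ≤ K₁ ‖f‖_{ℓ_p(X_n)}` for all `f ∈ L_p(𝕋)` and `n ≥ 1`. -/
def UpperSampling {𝕜 : Type*} [RCLike 𝕜] (p K₁ : ℝ) (x : ℕ → ℕ → ℝ) (φ : ℕ → ℕ → ℝ → 𝕜) : Prop :=
  ∀ (f : ℝ → 𝕜) (n : ℕ), MemLpT p f → 1 ≤ n →
    normT p (sampling x φ n f) ≤ K₁ * discNorm p n (x n) f

/-- `K₂ ‖f‖_{ℓ_p(X_n)} ≤ ‖G_n(f)‖_p` for all `f ∈ L_p(𝕋)` and `n ≥ 1`. -/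
def LowerSampling {𝕜 : Type*} [RCLike 𝕜] (p K₂ : ℝ) (x : ℕ → ℕ → ℝ) (φ : ℕ → ℕ → ℝ → 𝕜) : Prop :=
  ∀ (f : ℝ → 𝕜) (n : ℕ), MemLpT p f → 1 ≤ n →
    K₂ * discNorm p n (x n) f ≤ normT p (sampling x φ n f)

/-- `‖f - G_n(f)‖_p ≤ K₃ n^{-s} ‖f^{(s)}‖_p` for all `f ∈ W_p^s(𝕋)` and `n ≥ 1`. -/
def JacksonSampling {𝕜 : Type*} [RCLike 𝕜] (p : ℝ) (s : ℕ) (K₃ : ℝ) (x : ℕ → ℕ → ℝ)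
    (φ : ℕ → ℕ → ℝ → 𝕜) : Prop :=
  ∀ (f : ℝ → 𝕜) (n : ℕ), MemSobolevT p s f → 1 ≤ n →
    normT p (fun t => f t - sampling x φ n f t) ≤
      K₃ * ((n : ℝ) ^ s)⁻¹ * normT p (iteratedDeriv s f)

end

end SamplingLp

/-!
The proof compares `f` with an explicit smooth function `g`, chosen so that every error in the
argument is an average of finite differences of `f`. Let `A_a` be the average over a segment of
length `a`, and put `g = ∑_{j=1}^s (-1)^{j+1} C(s,j) A_{jh}^s f` with `h = γ / (2 s n)`
(`smoothing`).

* `f - g` is, up to sign, an average of differences `Δ_v^s f` with `v ≤ s h < 1/n`, so that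
  `‖f - g‖_p ≤ ω_s(f, 1/n)_p` by Minkowski's integral inequality (`sum_avg_memLpT_and_normT_le`,
  `normT_sub_smoothing_le`).
* `(A_a^s f)^{(s)} = a^{-s} Δ_a^s f` almost everywhere, so that `g ∈ W_p^s` and
  `‖g^{(s)}‖_p ≤ C n^s ω_s(f, 1/n)_p` (`smoothing_memSobolevT`). The Jackson hypothesis therefore
  bounds `‖g - G_n g‖_p`.
* An average over a segment no longer than the gaps between the nodes is bounded from `L_p` to
  `ℓ_p(X_n)`, since the segments issuing from the nodes do not overlap (`discNorm_avg_le`). The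
  Steklov average with `δ = γ / n` is a combination of such averages, which gives
  `‖(f - g)_δ‖_{ℓ_p(X_n)} ≤ C ‖f - g‖_p` (`discNorm_steklov_le`).
* Steklov averages commute with the `A_a`, so `g_δ - g` is a combination of the functions
  `A_{jh}^s (f_δ - f)`. The outermost average takes `L_p` to `ℓ_p(X_n)`, and
  `f_δ - f` is an average of central differences of order `2r ≥ s`; hence
  `‖g_δ - g‖_{ℓ_p(X_n)} ≤ C ‖f_δ - f‖_p ≤ C' ω_s(f, 1/n)_p`
  (`discNorm_steklov_smoothing_sub_le`, `normT_steklov_sub_le`).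

The two inequalities follow from the triangle inequality applied to
`f - G_n f = (f - g) + (g - G_n g) - G_n (f - g)` and to
`f_δ - f = (g - f) + (f - g)_δ + (g_δ - g)` at the nodes. In the lower estimate the constant does
not depend on `K₂`, because testing the hypotheses on the constant function `1` shows `K₂ ≤ K₁`.
-/

open MeasureTheory

namespace SamplingLp

noncomputable section

/-! ### Averages of locally integrable functions -/

/-- Integrability on every bounded interval. -/
def LocInt {𝕜 : Type*} [RCLike 𝕜] (f : ℝ → 𝕜) : Prop :=
  ∀ a b : ℝ, IntervalIntegrable f volume a b

/-- The average of `f` over the segment from `x` to `x + a`. The normalization to the unit interval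
makes sense for `a = 0` too, where the average is `f x`. -/
def avg {𝕜 : Type*} [RCLike 𝕜] (a : ℝ) (f : ℝ → 𝕜) (x : ℝ) : 𝕜 :=
  ∫ u in (0 : ℝ)..1, f (x + a * u)

/-- The difference quotient of step `a`. -/
def quot {𝕜 : Type*} [RCLike 𝕜] (a : ℝ) (f : ℝ → 𝕜) (x : ℝ) : 𝕜 :=
  a⁻¹ • (f (x + a) - f x)

section LocInt

variable {𝕜 : Type*} [RCLike 𝕜] {f g : ℝ → 𝕜}

theorem LocInt.of_continuous (hf : Continuous f) : LocInt f := fun a b => hf.intervalIntegrable a b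

theorem LocInt.sub (hf : LocInt f) (hg : LocInt g) : LocInt (fun x => f x - g x) :=
  fun a b => (hf a b).sub (hg a b)

theorem LocInt.const_mul (c : 𝕜) (hf : LocInt f) : LocInt (fun x => c * f x) :=
  fun a b => (hf a b).const_mul c

theorem LocInt.sum {ι : Type*} {I : Finset ι} {F : ι → ℝ → 𝕜} (hF : ∀ i ∈ I, LocInt (F i)) :
    LocInt (fun x => ∑ i ∈ I, F i x) := fun a b => by
  have := IntervalIntegrable.sum I (f := F) (μ := volume) (a := a) (b := b)
    (fun i hi => hF i hi a b)
  simpa [Finset.sum_fn] using this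

theorem LocInt.shift (τ : ℝ) (hf : LocInt f) : LocInt (fun x => f (x + τ)) := fun a b => by
  simpa using (hf (a + τ) (b + τ)).comp_add_right τ

theorem LocInt.comp_add_mul (hf : LocInt f) (x a : ℝ) :
    IntervalIntegrable (fun u => f (x + a * u)) volume 0 1 := by
  rcases eq_or_ne a 0 with rfl | ha
  · simp
  · have := ((hf.shift x) 0 (a * 1)).comp_mul_left (c := a)
    simpa [ha, add_comm] using this

theorem LocInt.quot (a : ℝ) (hf : LocInt f) : LocInt (quot a f) := fun c d => by
  have := ((hf.shift a).sub hf c d).smul (a⁻¹)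
  exact this

theorem LocInt.continuous_primitive (hf : LocInt f) :
    Continuous (fun x => ∫ t in (0 : ℝ)..x, f t) :=
  intervalIntegral.continuous_primitive hf 0

theorem avg_zero (f : ℝ → 𝕜) : avg 0 f = f := by
  funext x; simp [avg]

theorem avg_eq_integral {a : ℝ} (ha : a ≠ 0) (f : ℝ → 𝕜) (x : ℝ) :
    avg a f x = a⁻¹ • ∫ t in x..x + a, f t := by
  simp [avg, intervalIntegral.integral_comp_add_mul f ha x]

/-- An average is the difference quotient of a primitive. -/
theorem avg_eq_quot_primitive (hf : LocInt f) {a : ℝ} (ha : a ≠ 0) :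
    avg a f = quot a (fun x => ∫ t in (0 : ℝ)..x, f t) := by
  funext x
  rw [avg_eq_integral ha, SamplingLp.quot,
    intervalIntegral.integral_interval_sub_left (hf _ _) (hf _ _)]

/-- An average is a primitive of the difference quotient. -/
theorem avg_eq_primitive_quot (hf : LocInt f) {a : ℝ} (ha : a ≠ 0) :
    avg a f = fun x => avg a f 0 + ∫ t in (0 : ℝ)..x, quot a f t := by
  funext x
  have h1 : ∫ t in (0 : ℝ)..x, quot a f t
      = a⁻¹ • ((∫ t in (0 + a)..(x + a), f t) - ∫ t in (0 : ℝ)..x, f t) := by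
    rw [← intervalIntegral.integral_comp_add_right f a,
      ← intervalIntegral.integral_sub ((hf.shift a) _ _) (hf _ _),
      ← intervalIntegral.integral_smul]
    rfl
  rw [h1, avg_eq_integral ha, avg_eq_integral ha, ← smul_add]
  congr 1
  have h2 := intervalIntegral.integral_add_adjacent_intervals (hf 0 (0 + a)) (hf (0 + a) (x + a))
  have h3 := intervalIntegral.integral_add_adjacent_intervals (hf 0 x) (hf x (x + a))
  linear_combination h3 - h2

theorem continuous_avg (hf : LocInt f) {a : ℝ} (ha : a ≠ 0) : Continuous (avg a f) := by
  rw [avg_eq_primitive_quot hf ha]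
  exact continuous_const.add (hf.quot a).continuous_primitive

theorem LocInt.avg (a : ℝ) (hf : LocInt f) : LocInt (avg a f) := by
  rcases eq_or_ne a 0 with rfl | ha
  · rwa [avg_zero]
  · exact .of_continuous (continuous_avg hf ha)

theorem LocInt.avg_iterate (a : ℝ) (hf : LocInt f) (k : ℕ) : LocInt ((SamplingLp.avg a)^[k] f) := by
  induction k with
  | zero => exact hf
  | succ k ih => rw [Function.iterate_succ_apply']; exact ih.avg a

theorem avg_shift (a τ : ℝ) (f : ℝ → 𝕜) :
    avg a (fun x => f (x + τ)) = fun x => avg a f (x + τ) := by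
  funext x; simp [avg, add_right_comm]

theorem avg_const_mul (a : ℝ) (c : 𝕜) (f : ℝ → 𝕜) :
    avg a (fun x => c * f x) = fun x => c * avg a f x := by
  funext x; simp [avg]

theorem avg_sum {ι : Type*} {I : Finset ι} {F : ι → ℝ → 𝕜} (a : ℝ) (hF : ∀ i ∈ I, LocInt (F i)) :
    avg a (fun x => ∑ i ∈ I, F i x) = fun x => ∑ i ∈ I, avg a (F i) x := by
  funext x
  simp only [avg]
  exact intervalIntegral.integral_finsetSum fun i hi => (hF i hi).comp_add_mul x a

theorem avg_sub (a : ℝ) (hf : LocInt f) (hg : LocInt g) :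
    avg a (fun x => f x - g x) = fun x => avg a f x - avg a g x := by
  funext x
  exact intervalIntegral.integral_sub (hf.comp_add_mul x a) (hg.comp_add_mul x a)

theorem avg_quot (a b : ℝ) (hf : LocInt f) : avg a (quot b f) = quot b (avg a f) := by
  funext x
  have h := congrFun (avg_sub a (hf.shift b) hf) x
  simp only [avg_shift] at h
  rw [quot, ← h, avg, avg, ← intervalIntegral.integral_smul]
  rfl

theorem quot_comm (a b : ℝ) (f : ℝ → 𝕜) : quot a (quot b f) = quot b (quot a f) := by
  funext x
  simp only [quot, smul_sub, add_right_comm x a b, smul_comm a⁻¹ b⁻¹]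
  abel

/-- Averages commute: both iterated averages are the second-order difference quotient of a second
primitive of `f`. -/
theorem avg_comm (hf : LocInt f) (a b : ℝ) : avg a (avg b f) = avg b (avg a f) := by
  rcases eq_or_ne a 0 with rfl | ha
  · simp [avg_zero]
  rcases eq_or_ne b 0 with rfl | hb
  · simp [avg_zero]
  have hF : LocInt (fun x => ∫ t in (0 : ℝ)..x, f t) := .of_continuous hf.continuous_primitive
  rw [avg_eq_quot_primitive hf ha, avg_eq_quot_primitive hf hb, avg_quot _ _ hF, avg_quot _ _ hF,
    avg_eq_quot_primitive hF ha, avg_eq_quot_primitive hF hb, quot_comm]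

theorem avg_iterate_quot (a : ℝ) (hf : LocInt f) (k : ℕ) :
    (avg a)^[k] (quot a f) = quot a ((avg a)^[k] f) := by
  induction k with
  | zero => rfl
  | succ k ih =>
    rw [Function.iterate_succ_apply', ih, Function.iterate_succ_apply', avg_quot]
    exact hf.avg_iterate a k

theorem avg_quot_iterate (a : ℝ) (hf : LocInt f) (k : ℕ) :
    avg a ((quot a)^[k] f) = (quot a)^[k] (avg a f) := by
  induction k generalizing f with
  | zero => rfl
  | succ k ih =>
    rw [Function.iterate_succ_apply, ih (hf.quot a), Function.iterate_succ_apply, avg_quot _ _ hf]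

theorem LocInt.quot_iterate (a : ℝ) (hf : LocInt f) (k : ℕ) :
    LocInt ((SamplingLp.quot a)^[k] f) := by
  induction k with
  | zero => exact hf
  | succ k ih => rw [Function.iterate_succ_apply']; exact ih.quot a

end LocInt

/-! ### Smoothness of iterated averages -/

section Smooth

variable {𝕜 : Type*} [RCLike 𝕜] {f : ℝ → 𝕜}

theorem continuous_quot (hf : Continuous f) (a : ℝ) : Continuous (quot a f) := by
  unfold quot; fun_prop

theorem hasDerivAt_avg (hf : Continuous f) {a : ℝ} (ha : a ≠ 0) (x : ℝ) :
    HasDerivAt (avg a f) (quot a f x) x := by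
  rw [avg_eq_primitive_quot (.of_continuous hf) ha]
  exact ((continuous_quot hf a).integral_hasStrictDerivAt 0 x).hasDerivAt.const_add _

/-- Each average of a continuous function gains one derivative, which is a difference quotient. -/
theorem contDiff_avg_iterate (hf : Continuous f) {a : ℝ} (ha : a ≠ 0) (k : ℕ) :
    ContDiff ℝ k ((avg a)^[k] f) ∧ iteratedDeriv k ((avg a)^[k] f) = (quot a)^[k] f := by
  induction k generalizing f with
  | zero => exact ⟨by simpa using hf, by simp⟩
  | succ k ih =>
    have hc : Continuous ((avg a)^[k] f) := (ih hf).1.continuous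
    have hd : deriv ((avg a)^[k + 1] f) = (avg a)^[k] (quot a f) := by
      rw [Function.iterate_succ_apply', avg_iterate_quot a (.of_continuous hf)]
      funext x
      exact (hasDerivAt_avg hc ha x).deriv
    obtain ⟨h1, h2⟩ := ih (continuous_quot hf a)
    refine ⟨?_, ?_⟩
    · rw [show ((k + 1 : ℕ) : WithTop ℕ∞) = (k : WithTop ℕ∞) + 1 by push_cast; rfl,
        contDiff_succ_iff_deriv, hd]
      refine ⟨fun x => ?_, by simp, h1⟩
      rw [Function.iterate_succ_apply']
      exact (hasDerivAt_avg hc ha x).differentiableAt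
    · rw [iteratedDeriv_succ', hd, h2, Function.iterate_succ_apply]

/-- For a function that is only locally integrable, the first average is spent on continuity. -/
theorem contDiff_avg_iterate_succ (hf : LocInt f) {a : ℝ} (ha : a ≠ 0) (k : ℕ) :
    ContDiff ℝ k ((avg a)^[k + 1] f) ∧
      iteratedDeriv k ((avg a)^[k + 1] f) = avg a ((quot a)^[k] f) := by
  rw [Function.iterate_succ_apply, avg_quot_iterate a hf]
  exact contDiff_avg_iterate (continuous_avg hf ha) ha k

/-- Absolute continuity passes to a function whose increments are dominated. -/
theorem absolutelyContinuousOnInterval_of_dist_le {g : ℝ → ℝ} {a b : ℝ}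
    (hg : AbsolutelyContinuousOnInterval g a b) (h : ∀ x y, dist (f x) (f y) ≤ dist (g x) (g y)) :
    AbsolutelyContinuousOnInterval f a b :=
  squeeze_zero (fun _ => Finset.sum_nonneg fun _ _ => dist_nonneg)
    (fun _ => Finset.sum_le_sum fun _ _ => h _ _) hg

/-- Mathlib has the absolute continuity of indefinite integrals for real integrands; the increments
of a `𝕜`-valued primitive are dominated by those of the primitive of the norm. -/
theorem absolutelyContinuousOnInterval_primitive (hf : LocInt f) (c : 𝕜) (a b : ℝ) :
    AbsolutelyContinuousOnInterval (fun x => c + ∫ t in a..x, f t) a b := by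
  refine absolutelyContinuousOnInterval_of_dist_le
    ((hf a b).norm.absolutelyContinuousOnInterval_intervalIntegral (c := a) Set.left_mem_uIcc) ?_
  intro x y
  rw [dist_add_left, dist_eq_norm, dist_eq_norm,
    intervalIntegral.integral_interval_sub_left (hf _ _) (hf _ _),
    intervalIntegral.integral_interval_sub_left (hf _ _).norm (hf _ _).norm, Real.norm_eq_abs]
  exact intervalIntegral.norm_integral_le_abs_integral_norm

theorem LocInt.locallyIntegrable (hf : LocInt f) : LocallyIntegrable f volume := by
  intro x
  refine ⟨Set.Icc (x - 1) (x + 1), Icc_mem_nhds (by linarith) (by linarith), ?_⟩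
  exact (intervalIntegrable_iff_integrableOn_Icc_of_le (by linarith)).1 (hf _ _)

/-- A linear combination of `(k+1)`-fold averages has an absolutely continuous derivative of order
`k`, and its derivative of order `k + 1` is almost everywhere the same combination of difference
quotients. -/
theorem smooth_sum_avg_iterate {ι : Type*} (I : Finset ι) (c : ι → 𝕜) (a : ι → ℝ)
    (ha : ∀ i ∈ I, a i ≠ 0) (hf : LocInt f) (k : ℕ) :
    ContDiff ℝ k (fun x => ∑ i ∈ I, c i * (avg (a i))^[k + 1] f x) ∧
    AbsolutelyContinuousOnInterval
      (iteratedDeriv k (fun x => ∑ i ∈ I, c i * (avg (a i))^[k + 1] f x)) 0 1 ∧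
    iteratedDeriv (k + 1) (fun x => ∑ i ∈ I, c i * (avg (a i))^[k + 1] f x) =ᵐ[volume]
      fun x => ∑ i ∈ I, c i * (quot (a i))^[k + 1] f x := by
  have hcd : ∀ i ∈ I, ContDiff ℝ k (fun x => c i * (avg (a i))^[k + 1] f x) := fun i hi =>
    contDiff_const.mul (contDiff_avg_iterate_succ hf (ha i hi) k).1
  have hq : LocInt fun x => ∑ i ∈ I, c i * (quot (a i))^[k + 1] f x :=
    LocInt.sum fun i _ => (hf.quot_iterate (a i) (k + 1)).const_mul (c i)
  have hit : iteratedDeriv k (fun x => ∑ i ∈ I, c i * (avg (a i))^[k + 1] f x) =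
      fun x => (∑ i ∈ I, c i * avg (a i) ((quot (a i))^[k] f) 0) +
        ∫ t in (0 : ℝ)..x, ∑ i ∈ I, c i * (quot (a i))^[k + 1] f t := by
    funext x
    rw [iteratedDeriv_fun_sum (fun i hi => (hcd i hi).contDiffAt),
      intervalIntegral.integral_finsetSum
        (fun i _ => (hf.quot_iterate (a i) (k + 1)).const_mul (c i) _ _), ← Finset.sum_add_distrib]
    refine Finset.sum_congr rfl fun i hi => ?_
    rw [iteratedDeriv_const_mul_field, (contDiff_avg_iterate_succ hf (ha i hi) k).2,
      intervalIntegral.integral_const_mul, ← mul_add]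
    congr 1
    have := congrFun (avg_eq_primitive_quot (hf.quot_iterate (a i) k) (ha i hi)) x
    rw [this]
    simp only [Function.iterate_succ_apply']
  refine ⟨ContDiff.sum hcd, ?_, ?_⟩
  · rw [hit]
    exact absolutelyContinuousOnInterval_primitive hq _ 0 1
  · rw [iteratedDeriv_succ, hit]
    filter_upwards [LocallyIntegrable.ae_hasDerivAt_integral hq.locallyIntegrable] with x hx
    exact ((hx 0).const_add _).deriv

end Smooth

/-! ### The space `L_p` of periodic functions -/

section Lp

variable {𝕜 : Type*} [RCLike 𝕜] {p : ℝ} {f g : ℝ → 𝕜}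

theorem normT_nonneg (p : ℝ) (f : ℝ → 𝕜) : 0 ≤ normT p f :=
  Real.rpow_nonneg (integral_nonneg fun _ => Real.rpow_nonneg (norm_nonneg _) _) _

theorem eLpNorm_eq_ofReal_normT (hp : 1 ≤ p) (hf : MemLpT p f) :
    eLpNorm f (ENNReal.ofReal p) (volume.restrict (Set.Ico (0 : ℝ) 1)) =
      ENNReal.ofReal (normT p f) := by
  have hp0 : 0 < p := by linarith
  rw [hf.2.eLpNorm_eq_integral_rpow_norm (by simpa using hp0) ENNReal.ofReal_ne_top,
    ENNReal.toReal_ofReal hp0.le, normT, one_div]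

theorem lintegral_eq_ofReal_normT (hp : 1 ≤ p) (hf : MemLpT p f) :
    ∫⁻ x in Set.Ico (0 : ℝ) 1, ‖f x‖ₑ ^ p = ENNReal.ofReal (normT p f) ^ p := by
  have hp0 : 0 < p := by linarith
  rw [← eLpNorm_eq_ofReal_normT hp hf, eLpNorm_eq_lintegral_rpow_enorm_toReal (by simpa using hp0)
    ENNReal.ofReal_ne_top, ENNReal.toReal_ofReal hp0.le, ← ENNReal.rpow_mul, one_div,
    inv_mul_cancel₀ hp0.ne', ENNReal.rpow_one]

theorem normT_congr_ae (h : f =ᵐ[volume] g) : normT p f = normT p g := by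
  unfold normT
  congr 1
  exact integral_congr_ae (ae_restrict_of_ae (h.mono fun x hx => by simp only [hx]))

theorem MemLpT.sub (hf : MemLpT p f) (hg : MemLpT p g) : MemLpT p (fun x => f x - g x) :=
  ⟨fun x => by simp only [hf.1 x, hg.1 x], hf.2.sub hg.2⟩

theorem MemLpT.add (hf : MemLpT p f) (hg : MemLpT p g) : MemLpT p (fun x => f x + g x) :=
  ⟨fun x => by simp only [hf.1 x, hg.1 x], hf.2.add hg.2⟩

theorem MemLpT.const_mul (c : 𝕜) (hf : MemLpT p f) : MemLpT p (fun x => c * f x) :=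
  ⟨fun x => by simp only [hf.1 x], hf.2.const_mul c⟩

theorem MemLpT.sum {ι : Type*} {I : Finset ι} {F : ι → ℝ → 𝕜} (hF : ∀ i ∈ I, MemLpT p (F i)) :
    MemLpT p (fun x => ∑ i ∈ I, F i x) :=
  ⟨fun x => Finset.sum_congr rfl fun i hi => (hF i hi).1 x,
    memLp_finsetSum I fun i hi => (hF i hi).2⟩

theorem memLpT_one : MemLpT p (fun _ : ℝ => (1 : 𝕜)) := ⟨fun _ => rfl, memLp_const 1⟩

theorem normT_add_le (hp : 1 ≤ p) (hf : MemLpT p f) (hg : MemLpT p g) :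
    normT p (fun x => f x + g x) ≤ normT p f + normT p g := by
  have h := eLpNorm_add_le hf.2.1 hg.2.1 (ENNReal.one_le_ofReal.2 hp)
  rw [eLpNorm_eq_ofReal_normT hp hf, eLpNorm_eq_ofReal_normT hp hg,
    ← ENNReal.ofReal_add (normT_nonneg _ _) (normT_nonneg _ _)] at h
  have h2 := eLpNorm_eq_ofReal_normT hp (hf.add hg)
  exact (ENNReal.ofReal_le_ofReal_iff (add_nonneg (normT_nonneg _ _) (normT_nonneg _ _))).1
    (h2 ▸ h)

theorem normT_const_mul (hp : 1 ≤ p) (c : 𝕜) (f : ℝ → 𝕜) :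
    normT p (fun x => c * f x) = ‖c‖ * normT p f := by
  have hp0 : p ≠ 0 := by linarith
  simp only [normT, norm_mul, Real.mul_rpow (norm_nonneg _) (norm_nonneg _)]
  rw [integral_const_mul, Real.mul_rpow (by positivity)
    (integral_nonneg fun _ => Real.rpow_nonneg (norm_nonneg _) _), one_div,
    Real.rpow_rpow_inv (norm_nonneg c) hp0]

theorem normT_zero (hp : 1 ≤ p) : normT p (fun _ : ℝ => (0 : 𝕜)) = 0 := by
  simpa using normT_const_mul hp (0 : 𝕜) (fun _ => (0 : 𝕜))

theorem normT_neg (f : ℝ → 𝕜) : normT p (fun x => -f x) = normT p f := by simp [normT]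

theorem normT_sub_le (hp : 1 ≤ p) (hf : MemLpT p f) (hg : MemLpT p g) :
    normT p (fun x => f x - g x) ≤ normT p f + normT p g := by
  have h := normT_add_le hp hf (hg.const_mul (-1))
  simpa [normT_neg, ← sub_eq_add_neg] using h

theorem normT_sum_le {ι : Type*} (hp : 1 ≤ p) (I : Finset ι) {F : ι → ℝ → 𝕜}
    (hF : ∀ i ∈ I, MemLpT p (F i)) :
    normT p (fun x => ∑ i ∈ I, F i x) ≤ ∑ i ∈ I, normT p (F i) := by
  classical
  induction I using Finset.induction_on with
  | empty => simp [normT_zero hp]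
  | insert i I hi ih =>
    simp only [Finset.sum_insert hi]
    refine (normT_add_le hp (hF i (by simp))
      (MemLpT.sum fun j hj => hF j (by simp [hj]))).trans ?_
    gcongr
    exact ih fun j hj => hF j (by simp [hj])

theorem MemLpT.locInt (hp : 1 ≤ p) (hf : MemLpT p f) : LocInt f := by
  refine hf.1.intervalIntegrable₀ one_ne_zero ?_
  rw [intervalIntegrable_iff_integrableOn_Ico_of_le zero_le_one]
  exact hf.2.integrable (ENNReal.one_le_ofReal.2 hp)

theorem periodic_norm_rpow (hf : Function.Periodic f 1) (p : ℝ) :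
    Function.Periodic (fun x => ‖f x‖ ^ p) 1 := fun x => by simp only [hf x]

theorem MemLpT.locInt_norm_rpow (hp : 1 ≤ p) (hf : MemLpT p f) : LocInt (fun x => ‖f x‖ ^ p) := by
  have hp0 : 0 < p := by linarith
  refine (periodic_norm_rpow hf.1 p).intervalIntegrable₀ one_ne_zero ?_
  rw [intervalIntegrable_iff_integrableOn_Ico_of_le zero_le_one]
  have := hf.2.integrable_norm_rpow (by simpa using hp0) ENNReal.ofReal_ne_top
  rwa [ENNReal.toReal_ofReal hp0.le] at this

theorem normT_rpow (hp : 1 ≤ p) (f : ℝ → 𝕜) :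
    normT p f ^ p = ∫ x in (0 : ℝ)..1, ‖f x‖ ^ p := by
  have hp0 : p ≠ 0 := by linarith
  rw [normT, one_div, Real.rpow_inv_rpow
    (integral_nonneg fun _ => Real.rpow_nonneg (norm_nonneg _) _) hp0,
    intervalIntegral.integral_of_le zero_le_one, integral_Ico_eq_integral_Ioo,
    integral_Ioc_eq_integral_Ioo]

theorem normT_shift (hp : 1 ≤ p) (hf : Function.Periodic f 1) (τ : ℝ) :
    normT p (fun x => f (x + τ)) = normT p f := by
  have hp0 : p ≠ 0 := by linarith
  rw [← Real.rpow_left_inj (normT_nonneg _ _) (normT_nonneg _ _) hp0, normT_rpow hp, normT_rpow hp,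
    intervalIntegral.integral_comp_add_right (fun x => ‖f x‖ ^ p), zero_add, add_comm 1 τ]
  simpa using (periodic_norm_rpow hf p).intervalIntegral_add_eq τ 0

theorem MemLpT.shift (hp : 1 ≤ p) (hf : MemLpT p f) (τ : ℝ) : MemLpT p (fun x => f (x + τ)) := by
  have hp0 : 0 < p := by linarith
  refine ⟨fun x => by simp only [add_right_comm x 1 τ, hf.1 (x + τ)], ?_⟩
  have hm : AEStronglyMeasurable (fun x => f (x + τ)) (volume.restrict (Set.Ico (0 : ℝ) 1)) :=
    ((hf.locInt hp).shift τ).locallyIntegrable.aestronglyMeasurable.restrict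
  rw [← integrable_norm_rpow_iff hm (by simpa using hp0) ENNReal.ofReal_ne_top,
    ENNReal.toReal_ofReal hp0.le]
  have h := (hf.locInt_norm_rpow hp).shift τ 0 1
  rwa [intervalIntegrable_iff_integrableOn_Ico_of_le zero_le_one] at h

/-- Hölder's inequality for an integral over the unit interval. -/
theorem enorm_integral_rpow_le (hp : 1 ≤ p) (hf : IntervalIntegrable f volume 0 1) :
    ‖∫ u in (0 : ℝ)..1, f u‖ₑ ^ p ≤ ∫⁻ u in Set.Ioc (0 : ℝ) 1, ‖f u‖ₑ ^ p := by
  have hp0 : 0 < p := by linarith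
  have : IsProbabilityMeasure (volume.restrict (Set.Ioc (0 : ℝ) 1)) := ⟨by simp⟩
  have hm : AEStronglyMeasurable f (volume.restrict (Set.Ioc (0 : ℝ) 1)) := hf.1.1
  rw [intervalIntegral.integral_of_le zero_le_one]
  have h := eLpNorm'_le_eLpNorm'_of_exponent_le one_pos hp _ hm
  simp only [eLpNorm', ENNReal.rpow_one, one_div, inv_one] at h
  calc _ ≤ (∫⁻ u in Set.Ioc (0 : ℝ) 1, ‖f u‖ₑ) ^ p := by
        gcongr; exact enorm_integral_le_lintegral_enorm _
    _ ≤ ((∫⁻ u in Set.Ioc (0 : ℝ) 1, ‖f u‖ₑ ^ p) ^ p⁻¹) ^ p := by gcongr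
    _ = _ := by rw [← ENNReal.rpow_mul, inv_mul_cancel₀ hp0.ne', ENNReal.rpow_one]

end Lp

/-! ### Averaging in `L_p` and in the discrete norm -/

section Averaging

variable {𝕜 : Type*} [RCLike 𝕜] {p : ℝ} {f g : ℝ → 𝕜}

/-- Joint measurability in the variable and the parameter. For `f` measurable only up to a null set
it needs the map `(x, u) ↦ x + α + β u` to pull null sets back to null sets. -/
theorem aestronglyMeasurable_comp_affine (hf : AEStronglyMeasurable f volume) (α β : ℝ) :
    AEStronglyMeasurable (fun z : ℝ × ℝ => f (z.1 + α + β * z.2))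
      ((volume.restrict (Set.Ico (0 : ℝ) 1)).prod (volume.restrict (Set.Ioc (0 : ℝ) 1))) := by
  have h1 : MeasurePreserving (fun z : ℝ × ℝ => (z.1, z.2 + (α + β * z.1)))
      ((volume : Measure ℝ).prod (volume : Measure ℝ)) (volume.prod volume) :=
    (MeasurePreserving.id volume).skew_product (g := fun u x => x + (α + β * u))
      (by fun_prop) (Filter.Eventually.of_forall fun u =>
        (measurePreserving_add_right volume _).map_eq)
  have h2 := (Measure.quasiMeasurePreserving_snd (μ := (volume : Measure ℝ))
    (ν := (volume : Measure ℝ))).comp (h1.quasiMeasurePreserving.comp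
      (Measure.measurePreserving_swap (μ := (volume : Measure ℝ))
        (ν := (volume : Measure ℝ))).quasiMeasurePreserving)
  have h3 := hf.comp_quasiMeasurePreserving h2
  rw [Measure.prod_restrict]
  refine (h3.congr (Filter.Eventually.of_forall fun z => ?_)).restrict
  simp [Function.comp_def, add_assoc]

/-- Minkowski's integral inequality in the form used here: a bound for the norm of a combination of
translates that is uniform in the parameter `u` passes to the average over `u`. -/
theorem sum_avg_memLpT_and_normT_le {ι : Type*} (hp : 1 ≤ p) (I : Finset ι) (F : ι → ℝ → 𝕜)
    (hF : ∀ i ∈ I, MemLpT p (F i)) (α β : ι → ℝ) {M : ℝ} (hM : 0 ≤ M)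
    (h : ∀ u ∈ Set.Ioo (0 : ℝ) 1, normT p (fun x => ∑ i ∈ I, F i (x + α i + β i * u)) ≤ M) :
    MemLpT p (fun x => ∑ i ∈ I, avg (β i) (F i) (x + α i)) ∧
      normT p (fun x => ∑ i ∈ I, avg (β i) (F i) (x + α i)) ≤ M := by
  have hp0 : 0 < p := by linarith
  have hint : ∀ x, ∀ i ∈ I, IntervalIntegrable (fun u => F i (x + α i + β i * u)) volume 0 1 :=
    fun x i hi => ((hF i hi).locInt hp).comp_add_mul _ _
  have heq : (fun x => ∑ i ∈ I, avg (β i) (F i) (x + α i)) =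
      fun x => ∫ u in (0 : ℝ)..1, ∑ i ∈ I, F i (x + α i + β i * u) := by
    funext x
    rw [intervalIntegral.integral_finsetSum (hint x)]
    rfl
  have hmeas : AEStronglyMeasurable (fun z : ℝ × ℝ => ∑ i ∈ I, F i (z.1 + α i + β i * z.2))
      ((volume.restrict (Set.Ico (0 : ℝ) 1)).prod (volume.restrict (Set.Ioc (0 : ℝ) 1))) :=
    Finset.aestronglyMeasurable_fun_sum I fun i hi =>
      aestronglyMeasurable_comp_affine
        ((hF i hi).locInt hp).locallyIntegrable.aestronglyMeasurable _ _
  have hm : AEStronglyMeasurable (fun x => ∑ i ∈ I, avg (β i) (F i) (x + α i))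
      (volume.restrict (Set.Ico (0 : ℝ) 1)) := by
    rw [heq]
    simp only [intervalIntegral.integral_of_le zero_le_one]
    exact hmeas.integral_prod_right'
  have hmem : ∀ u, MemLpT p (fun x => ∑ i ∈ I, F i (x + α i + β i * u)) := fun u =>
    MemLpT.sum fun i hi => by simpa only [add_assoc] using (hF i hi).shift hp (α i + β i * u)
  have hle : ∫⁻ x in Set.Ico (0 : ℝ) 1, ‖∑ i ∈ I, avg (β i) (F i) (x + α i)‖ₑ ^ p
      ≤ ENNReal.ofReal M ^ p := by
    calc _ ≤ ∫⁻ x in Set.Ico (0 : ℝ) 1, ∫⁻ u in Set.Ioc (0 : ℝ) 1,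
            ‖∑ i ∈ I, F i (x + α i + β i * u)‖ₑ ^ p := by
          refine lintegral_mono fun x => ?_
          rw [congrFun heq x]
          refine enorm_integral_rpow_le hp ?_
          simpa [Finset.sum_fn] using
            IntervalIntegrable.sum I (f := fun i u => F i (x + α i + β i * u)) (hint x)
      _ = ∫⁻ u in Set.Ioc (0 : ℝ) 1, ∫⁻ x in Set.Ico (0 : ℝ) 1,
            ‖∑ i ∈ I, F i (x + α i + β i * u)‖ₑ ^ p :=
          lintegral_lintegral_swap (hmeas.enorm.pow_const p)
      _ ≤ ∫⁻ _u in Set.Ioo (0 : ℝ) 1, ENNReal.ofReal M ^ p := by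
          rw [setLIntegral_congr (Ioo_ae_eq_Ioc (a := (0 : ℝ)) (b := 1)).symm]
          refine setLIntegral_mono' measurableSet_Ioo fun u hu => ?_
          rw [lintegral_eq_ofReal_normT hp (hmem u)]
          gcongr
          exact h u hu
      _ = _ := by simp
  have hmem' : MemLpT p (fun x => ∑ i ∈ I, avg (β i) (F i) (x + α i)) := by
    refine ⟨fun x => ?_, hm, ?_⟩
    · refine Finset.sum_congr rfl fun i hi => ?_
      simp only [avg]
      congr 1
      funext u
      rw [← (hF i hi).1 (x + α i + β i * u)]
      congr 1
      ring
    · rw [eLpNorm_lt_top_iff_lintegral_rpow_enorm_lt_top (by simpa using hp0)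
        ENNReal.ofReal_ne_top, ENNReal.toReal_ofReal hp0.le]
      exact hle.trans_lt (ENNReal.rpow_lt_top_of_nonneg hp0.le ENNReal.ofReal_ne_top)
  refine ⟨hmem', ?_⟩
  rw [lintegral_eq_ofReal_normT hp hmem', ENNReal.rpow_le_rpow_iff hp0] at hle
  exact (ENNReal.ofReal_le_ofReal_iff hM).1 hle

theorem avg_memLpT_and_normT_le (hp : 1 ≤ p) (hf : MemLpT p f) (a : ℝ) :
    MemLpT p (avg a f) ∧ normT p (avg a f) ≤ normT p f := by
  have := sum_avg_memLpT_and_normT_le hp {()} (fun _ => f) (fun _ _ => hf) (fun _ => 0)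
    (fun _ => a) (normT_nonneg p f) (fun u _ => by simpa using (normT_shift hp hf.1 (a * u)).le)
  simpa using this

theorem MemLpT.avg_iterate (hp : 1 ≤ p) (hf : MemLpT p f) (a : ℝ) (k : ℕ) :
    MemLpT p ((avg a)^[k] f) := by
  induction k with
  | zero => exact hf
  | succ k ih =>
    rw [Function.iterate_succ_apply']
    exact (avg_memLpT_and_normT_le hp ih a).1

theorem normT_avg_iterate_le (hp : 1 ≤ p) (hf : MemLpT p f) (a : ℝ) (k : ℕ) :
    normT p ((avg a)^[k] f) ≤ normT p f := by
  induction k with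
  | zero => rfl
  | succ k ih =>
    rw [Function.iterate_succ_apply']
    exact (avg_memLpT_and_normT_le hp (hf.avg_iterate hp a k) a).2.trans ih

theorem discNorm_add_le (hp : 1 ≤ p) (n : ℕ) (y : ℕ → ℝ) (f g : ℝ → 𝕜) :
    discNorm p n y (fun x => f x + g x) ≤ discNorm p n y f + discNorm p n y g := by
  have hp0 : 0 < p := by linarith
  simp only [discNorm]
  rw [Real.mul_rpow (by positivity) (by positivity), Real.mul_rpow (by positivity) (by positivity),
    Real.mul_rpow (by positivity) (by positivity), ← mul_add]
  gcongr
  refine le_trans ?_ (Real.Lp_add_le_of_nonneg (Finset.Icc 1 n) hp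
    (f := fun k => ‖f (y k)‖) (g := fun k => ‖g (y k)‖) (fun _ _ => norm_nonneg _)
    (fun _ _ => norm_nonneg _))
  gcongr
  exact norm_add_le _ _

theorem discNorm_const_mul (hp : 1 ≤ p) (n : ℕ) (y : ℕ → ℝ) (c : 𝕜) (f : ℝ → 𝕜) :
    discNorm p n y (fun x => c * f x) = ‖c‖ * discNorm p n y f := by
  have hp0 : p ≠ 0 := by linarith
  simp only [discNorm, norm_mul, Real.mul_rpow (norm_nonneg _) (norm_nonneg _)]
  rw [← Finset.mul_sum, mul_left_comm, Real.mul_rpow (by positivity) (by positivity), one_div p,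
    Real.rpow_rpow_inv (norm_nonneg c) hp0]

theorem discNorm_sum_le {ι : Type*} (hp : 1 ≤ p) (n : ℕ) (y : ℕ → ℝ) (I : Finset ι)
    (F : ι → ℝ → 𝕜) :
    discNorm p n y (fun x => ∑ i ∈ I, F i x) ≤ ∑ i ∈ I, discNorm p n y (F i) := by
  classical
  induction I using Finset.induction_on with
  | empty =>
    have h := discNorm_const_mul hp n y (0 : 𝕜) (fun _ => 0)
    simp only [zero_mul, norm_zero] at h
    simp [h]
  | insert i I hi ih =>
    simp only [Finset.sum_insert hi]
    exact (discNorm_add_le hp n y _ _).trans (by gcongr)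

/-- The real form of Hölder's inequality for an average. -/
theorem norm_avg_rpow_le (hp : 1 ≤ p) (hf : MemLpT p f) (a x : ℝ) :
    ‖avg a f x‖ ^ p ≤ avg a (fun y => ‖f y‖ ^ p) x := by
  have hp0 : 0 < p := by linarith
  have h := enorm_integral_rpow_le hp ((hf.locInt hp).comp_add_mul x a)
  have hi := (hf.locInt_norm_rpow hp).comp_add_mul x a
  have e : ∫⁻ u in Set.Ioc (0 : ℝ) 1, ‖f (x + a * u)‖ₑ ^ p =
      ENNReal.ofReal (avg a (fun y => ‖f y‖ ^ p) x) := by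
    rw [avg, intervalIntegral.integral_of_le zero_le_one, ofReal_integral_eq_lintegral_ofReal hi.1
      (Filter.Eventually.of_forall fun u => by positivity)]
    refine lintegral_congr fun u => ?_
    rw [← ENNReal.ofReal_rpow_of_nonneg (norm_nonneg _) hp0.le, ofReal_norm]
  rw [e, ← ofReal_norm, ENNReal.ofReal_rpow_of_nonneg (norm_nonneg _) hp0.le] at h
  refine (ENNReal.ofReal_le_ofReal_iff ?_).1 h
  exact intervalIntegral.integral_nonneg zero_le_one fun u _ => by positivity

/-- Averages over segments shorter than the gaps between the nodes are bounded from `L_p` to the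
discrete norm, because the segments issuing from the nodes do not overlap. -/
theorem discNorm_avg_le (hp : 1 ≤ p) (hf : MemLpT p f) {γ : ℝ} {x : ℕ → ℕ → ℝ}
    (hx : IsNodeSystem γ x) {n : ℕ} (hn : 1 ≤ n) {a : ℝ} (ha : 0 < a) (han : a ≤ γ / n) (τ : ℝ) :
    discNorm p n (x n) (fun t => avg a f (t + τ)) ≤ (1 / (n * a)) ^ (1 / p) * normT p f := by
  have hp0 : 0 < p := by linarith
  have hn0 : (0 : ℝ) < n := by exact_mod_cast hn
  set G : ℝ → ℝ := fun t => ‖f (t + τ)‖ ^ p with hG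
  have hfs := hf.shift hp τ
  have hGi : LocInt G := hfs.locInt_norm_rpow hp
  have hpt : ∀ k ∈ Finset.Icc 1 n, ‖avg a f (x n k + τ)‖ ^ p ≤
      a⁻¹ * ∫ t in (x n k)..(x n (k + 1)), G t := by
    intro k hk
    rw [Finset.mem_Icc] at hk
    have h1 := norm_avg_rpow_le hp hfs a (x n k)
    rw [avg_shift, avg_eq_integral ha.ne'] at h1
    refine h1.trans ?_
    rw [smul_eq_mul]
    gcongr
    have hsep := hx.separated n k hk.1 hk.2
    refine intervalIntegral.integral_mono_interval le_rfl (by linarith) (by linarith)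
      (Filter.Eventually.of_forall fun t => by simp only [Pi.zero_apply]; positivity) (hGi _ _)
  have hsum : ∑ k ∈ Finset.Icc 1 n, ∫ t in (x n k)..(x n (k + 1)), G t = normT p f ^ p := by
    have h1 := intervalIntegral.sum_integral_adjacent_intervals_Ico (a := x n) (μ := volume)
      (f := G) (Nat.le_succ_of_le hn) (fun k _ => hGi _ _)
    rw [← normT_shift hp hf.1 τ, normT_rpow hp, show Finset.Icc 1 n = Finset.Ico 1 n.succ by
      ext; simp, h1, Nat.succ_eq_add_one, hx.wrap n hn, add_comm 1 (x n 1)]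
    simpa using (periodic_norm_rpow hfs.1 p).intervalIntegral_add_eq (x n 1) 0
  have h : (1 / (n : ℝ)) * ∑ k ∈ Finset.Icc 1 n, ‖avg a f (x n k + τ)‖ ^ p ≤
      1 / (n * a) * normT p f ^ p := by
    calc _ ≤ (1 / (n : ℝ)) * ∑ k ∈ Finset.Icc 1 n, a⁻¹ * ∫ t in (x n k)..(x n (k + 1)), G t := by
          gcongr with k hk; exact hpt k hk
      _ = _ := by
          rw [← Finset.mul_sum, hsum]; field_simp
  calc discNorm p n (x n) (fun t => avg a f (t + τ))
      ≤ (1 / (n * a) * normT p f ^ p) ^ (1 / p) := by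
        unfold discNorm; gcongr
    _ = _ := by
        rw [Real.mul_rpow (by positivity) (Real.rpow_nonneg (normT_nonneg _ _) _), one_div p,
          Real.rpow_rpow_inv (normT_nonneg _ _) hp0.ne']

end Averaging

/-! ### Finite differences and the modulus of smoothness -/

section Differences

variable {𝕜 : Type*} [RCLike 𝕜] {p : ℝ} {f g : ℝ → 𝕜}

/-- The difference as an alternating sum over the number of steps. -/
theorem diff_eq_sum (s : ℕ) (h : ℝ) (f : ℝ → 𝕜) (x : ℝ) :
    diff s h f x =
      (-1) ^ s * ∑ j ∈ Finset.range (s + 1), (-1) ^ j * (s.choose j : 𝕜) * f (x + j * h) := by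
  rw [diff, ← Finset.sum_range_reflect, Finset.mul_sum]
  refine Finset.sum_congr rfl fun j hj => ?_
  have hj' : j ≤ s := Nat.lt_succ_iff.1 (Finset.mem_range.1 hj)
  rw [show s + 1 - 1 - j = s - j by omega, Nat.choose_symm hj', Nat.cast_sub hj', sub_sub_cancel]
  have : (-1 : 𝕜) ^ s * (-1) ^ j = (-1) ^ (s - j) := by
    rw [← pow_add, show s + j = s - j + 2 * j by omega, pow_add, pow_mul]; simp
  linear_combination -(s.choose j : 𝕜) * f (x + j * h) * this

theorem diff_eq_fwdDiff_iterate (s : ℕ) (h : ℝ) (f : ℝ → 𝕜) : diff s h f = (fwdDiff h)^[s] f := by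
  funext x
  rw [diff_eq_sum, fwdDiff_iter_eq_sum_shift, Finset.mul_sum]
  refine Finset.sum_congr rfl fun j hj => ?_
  have hj' : j ≤ s := Nat.lt_succ_iff.1 (Finset.mem_range.1 hj)
  have : (-1 : 𝕜) ^ s * (-1) ^ j = (-1) ^ (s - j) := by
    rw [← pow_add, show s + j = s - j + 2 * j by omega, pow_add, pow_mul]; simp
  rw [zsmul_eq_mul, nsmul_eq_mul]
  push_cast
  rw [← this]
  ring

theorem MemLpT.diff (hp : 1 ≤ p) (hf : MemLpT p f) (s : ℕ) (h : ℝ) : MemLpT p (diff s h f) :=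
  MemLpT.sum fun _ _ => (hf.shift hp _).const_mul _

theorem diff_succ (s : ℕ) (h : ℝ) (f : ℝ → 𝕜) :
    diff (s + 1) h f = fun x => diff s h f (x + h) - diff s h f x := by
  rw [diff_eq_fwdDiff_iterate, Function.iterate_succ_apply', ← diff_eq_fwdDiff_iterate]
  rfl

theorem diff_zero_step {s : ℕ} (hs : 1 ≤ s) (f : ℝ → 𝕜) : diff s 0 f = fun _ => 0 := by
  obtain ⟨k, rfl⟩ := Nat.exists_eq_add_of_le' hs
  rw [diff_succ]
  simp

theorem normT_diff_add_le (hp : 1 ≤ p) (hf : MemLpT p f) (s m : ℕ) (h : ℝ) :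
    normT p (diff (s + m) h f) ≤ 2 ^ m * normT p (diff s h f) := by
  induction m with
  | zero => simp
  | succ m ih =>
    have hd := hf.diff hp (s + m) h
    rw [← add_assoc, diff_succ]
    have h1 := normT_sub_le hp (hd.shift hp h) hd
    rw [normT_shift hp hd.1] at h1
    rw [pow_succ]
    linarith

theorem modulus_nonneg (p : ℝ) (s : ℕ) (f : ℝ → 𝕜) (δ : ℝ) : 0 ≤ modulus p s f δ :=
  Real.sSup_nonneg (by rintro _ ⟨h, _, rfl⟩; exact normT_nonneg _ _)

theorem normT_diff_le_modulus (hp : 1 ≤ p) (hf : MemLpT p f) (s : ℕ) {h δ : ℝ} (h0 : 0 < h)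
    (hδ : h < δ) : normT p (diff s h f) ≤ modulus p s f δ := by
  refine le_csSup ⟨2 ^ s * normT p f, ?_⟩ ⟨h, ⟨h0, hδ⟩, rfl⟩
  rintro _ ⟨v, _, rfl⟩
  simpa [diff_eq_fwdDiff_iterate 0] using normT_diff_add_le hp hf 0 s v

/-- The step `0`, excluded from the modulus, is allowed here because the difference then
vanishes. -/
theorem normT_diff_le_of_le (hp : 1 ≤ p) (hf : MemLpT p f) {s m : ℕ} (hs : 1 ≤ s) (hsm : s ≤ m)
    {h δ : ℝ} (h0 : 0 ≤ h) (hδ : h < δ) :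
    normT p (diff m h f) ≤ 2 ^ (m - s) * modulus p s f δ := by
  rcases h0.eq_or_lt with rfl | h0
  · rw [diff_zero_step (hs.trans hsm), normT_zero hp]
    have := modulus_nonneg p s f δ
    positivity
  · obtain ⟨k, rfl⟩ := Nat.exists_eq_add_of_le hsm
    rw [Nat.add_sub_cancel_left]
    refine (normT_diff_add_le hp hf s k h).trans ?_
    gcongr
    exact normT_diff_le_modulus hp hf s h0 hδ

theorem quot_iterate_eq_diff (a : ℝ) (f : ℝ → 𝕜) (k : ℕ) :
    (quot a)^[k] f = fun x => ((a⁻¹ ^ k : ℝ) : 𝕜) * diff k a f x := by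
  induction k with
  | zero => funext x; simp [diff_eq_fwdDiff_iterate 0]
  | succ k ih =>
    rw [Function.iterate_succ_apply', ih, diff_succ]
    funext x
    rw [quot, RCLike.real_smul_eq_coe_mul, pow_succ, RCLike.ofReal_mul]
    ring

end Differences

/-! ### Smooth approximation -/

section Smoothing

variable {𝕜 : Type*} [RCLike 𝕜] {p : ℝ} {f g : ℝ → 𝕜}

/-- The combination `∑_{j=1}^s (-1)^{j+1} C(s,j) A_{jh}^s f`, where `A_a` is the average over a
segment of length `a`. Its distance from `f` is an average of differences of order `s` of `f`, while
its derivative of order `s` is a combination of such differences. -/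
def smoothing (s : ℕ) (h : ℝ) (f : ℝ → 𝕜) (x : ℝ) : 𝕜 :=
  ∑ j ∈ Finset.Icc 1 s, (-1) ^ (j + 1) * (s.choose j : 𝕜) * (avg (j * h))^[s] f x

theorem MemLpT.smoothing (hp : 1 ≤ p) (hf : MemLpT p f) (s : ℕ) (h : ℝ) :
    MemLpT p (smoothing s h f) :=
  MemLpT.sum fun _ _ => (hf.avg_iterate hp _ _).const_mul _

/-- Averaging `k` times in the step preserves a bound on the differences of order `s`, at the cost
of shrinking the range of steps. -/
theorem normT_sum_avg_iterate_le (hp : 1 ≤ p) (hf : MemLpT p f) (s : ℕ) {h δ : ℝ} (hh : 0 < h)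
    (k : ℕ) (v : ℝ) (hv : 0 ≤ v) (hvk : 0 < v ∨ 0 < k) (hδ : v + k * h < δ) :
    normT p (fun x => ∑ j ∈ Finset.range (s + 1),
      (-1) ^ j * (s.choose j : 𝕜) * (avg (j * h))^[k] f (x + j * v)) ≤ modulus p s f δ := by
  induction k generalizing v with
  | zero =>
    have hv0 : 0 < v := by simpa using hvk
    refine le_of_eq_of_le ?_ (normT_diff_le_modulus hp hf s hv0 (by simpa using hδ))
    rw [show diff s v f = fun x => (-1) ^ s * ∑ j ∈ Finset.range (s + 1),
      (-1) ^ j * (s.choose j : 𝕜) * f (x + j * v) from funext (diff_eq_sum s v f),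
      normT_const_mul hp]
    simp
  | succ k ih =>
    have := (sum_avg_memLpT_and_normT_le hp (Finset.range (s + 1))
      (fun j x => (-1) ^ j * (s.choose j : 𝕜) * (avg (j * h))^[k] f x)
      (fun j _ => (hf.avg_iterate hp _ _).const_mul _) (fun j => j * v) (fun j => j * h)
      (modulus_nonneg p s f δ) (fun u hu => ?_)).2
    · simpa only [avg_const_mul, ← Function.iterate_succ_apply' (avg _)] using this
    · have hhu : 0 < h * u := mul_pos hh hu.1
      have hhu1 : h * u < h := mul_lt_of_lt_one_right hh hu.2
      push_cast at hδ
      have e : ∀ (x : ℝ) (j : ℕ), x + j * v + j * h * u = x + j * (v + h * u) := fun x j => by ring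
      simp only [e]
      exact ih (v + h * u) (by linarith) (Or.inl (by linarith)) (by linarith)

/-- The error of the smooth approximation is an average of differences with steps below `δ`: this is
the bound for `s`-fold averages at `v = 0`, whose term `j = 0` is `f` itself. -/
theorem normT_sub_smoothing_le (hp : 1 ≤ p) (hf : MemLpT p f) {s : ℕ} (hs : 1 ≤ s) {h δ : ℝ}
    (hh : 0 < h) (hδ : s * h < δ) :
    normT p (fun x => f x - smoothing s h f x) ≤ modulus p s f δ := by
  refine le_of_eq_of_le ?_
    (normT_sum_avg_iterate_le hp hf s hh s 0 le_rfl (Or.inr hs) (by simpa using hδ))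
  congr 1
  funext x
  have h0 : (avg (((0 : ℕ) : ℝ) * h))^[s] f = f := by
    rw [Nat.cast_zero, zero_mul, Function.iterate_fixed (avg_zero f)]
  rw [Finset.range_eq_Ico, Finset.sum_eq_sum_Ico_succ_bot (Nat.succ_pos s), h0, smoothing,
    show Finset.Ico (0 + 1) (s + 1) = Finset.Icc 1 s by ext; simp, sub_eq_add_neg,
    ← Finset.sum_neg_distrib]
  simp [pow_succ]

theorem sum_norm_choose_le (s : ℕ) (I : Finset ℕ) (hI : I ⊆ Finset.range (s + 1)) (e : ℕ → ℕ) :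
    ∑ j ∈ I, ‖(-1) ^ e j * (s.choose j : 𝕜)‖ ≤ 2 ^ s := by
  simp only [norm_mul, norm_pow, norm_neg, norm_one, one_pow, one_mul, RCLike.norm_natCast]
  calc ∑ j ∈ I, (s.choose j : ℝ) ≤ ∑ j ∈ Finset.range (s + 1), (s.choose j : ℝ) :=
        Finset.sum_le_sum_of_subset_of_nonneg hI fun _ _ _ => by positivity
    _ = 2 ^ s := by exact_mod_cast Nat.sum_range_choose s

theorem Icc_one_subset_range (s : ℕ) : Finset.Icc 1 s ⊆ Finset.range (s + 1) := fun _ hj =>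
  Finset.mem_range.2 (Nat.lt_succ_of_le (Finset.mem_Icc.1 hj).2)

/-- The Bernstein-type bound: the derivative of order `s` of the smooth approximation is a
combination of the quotients `(j h)^{-s} Δ_{jh}^s f`. -/
theorem smoothing_memSobolevT (hp : 1 ≤ p) (hf : MemLpT p f) {s : ℕ} (hs : 1 ≤ s) {h δ : ℝ}
    (hh : 0 < h) (hδ : s * h < δ) :
    MemSobolevT p s (smoothing s h f) ∧
      normT p (iteratedDeriv s (smoothing s h f)) ≤ 2 ^ s * (h⁻¹ ^ s * modulus p s f δ) := by
  have hs1 : s - 1 + 1 = s := Nat.sub_add_cancel hs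
  have hj0 : ∀ j ∈ Finset.Icc 1 s, (j : ℝ) * h ≠ 0 := fun j hj => by
    have : (0 : ℝ) < j := by exact_mod_cast (Finset.mem_Icc.1 hj).1
    positivity
  obtain ⟨h1, h2, h3⟩ := smooth_sum_avg_iterate (Finset.Icc 1 s)
    (fun j => (-1) ^ (j + 1) * (s.choose j : 𝕜)) (fun j => (j : ℝ) * h) hj0 (hf.locInt hp) (s - 1)
  rw [hs1] at h1 h2 h3
  have hq : ∀ j : ℕ, MemLpT p ((quot ((j : ℝ) * h))^[s] f) := fun j => by
    rw [quot_iterate_eq_diff]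
    exact (hf.diff hp s _).const_mul _
  have hper : Function.Periodic (iteratedDeriv s (smoothing s h f)) 1 := fun x => by
    rw [← congrFun (iteratedDeriv_comp_add_const s (smoothing s h f) 1) x]
    congr 1
    funext y
    exact (hf.smoothing hp s h).1 y
  refine ⟨⟨(hf.smoothing hp s h).1, h1, h2, hper, ?_⟩, ?_⟩
  · refine (memLp_congr_ae (ae_restrict_of_ae h3)).2 ?_
    exact (MemLpT.sum (I := Finset.Icc 1 s) fun j _ => (hq j).const_mul _).2
  · calc normT p (iteratedDeriv s (smoothing s h f)) = _ := normT_congr_ae h3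
      _ ≤ ∑ j ∈ Finset.Icc 1 s, normT p (fun x => (-1) ^ (j + 1) * (s.choose j : 𝕜) *
            (quot ((j : ℝ) * h))^[s] f x) :=
          normT_sum_le hp _ fun j _ => (hq j).const_mul _
      _ ≤ ∑ j ∈ Finset.Icc 1 s, ‖(-1) ^ (j + 1) * (s.choose j : 𝕜)‖ *
            (h⁻¹ ^ s * modulus p s f δ) := by
          refine Finset.sum_le_sum fun j hj => ?_
          have hj1 : (1 : ℝ) ≤ j := by exact_mod_cast (Finset.mem_Icc.1 hj).1
          have hjs : (j : ℝ) ≤ s := by exact_mod_cast (Finset.mem_Icc.1 hj).2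
          have hjh : h ≤ j * h := le_mul_of_one_le_left hh.le hj1
          rw [normT_const_mul hp, quot_iterate_eq_diff, normT_const_mul hp, RCLike.norm_ofReal,
            abs_of_nonneg (by positivity)]
          gcongr
          · exact normT_nonneg _ _
          · exact normT_diff_le_modulus hp hf s (by positivity)
              (lt_of_le_of_lt (by gcongr) hδ)
      _ ≤ _ := by
          rw [← Finset.sum_mul]
          have := modulus_nonneg p s f δ
          gcongr
          exact sum_norm_choose_le s _ (Icc_one_subset_range s) _

end Smoothing

/-! ### The Steklov average -/

section Steklov

variable {𝕜 : Type*} [RCLike 𝕜] {p : ℝ} {f g : ℝ → 𝕜}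

/-- The dilation factor `(r - ν) / r` in the Steklov average. -/
def dilation (r ν : ℕ) : ℝ := ((r : ℝ) - (ν : ℝ)) / (r : ℝ)

/-- The average of `f` over the segment of length `|c| δ` centred at `x`, where `c = (r - ν) / r`.
It is defined for `ν > r` too, where `c` is negative and the segment is traversed backwards. -/
def centredAvg (δ : ℝ) (r ν : ℕ) (f : ℝ → 𝕜) (x : ℝ) : 𝕜 :=
  avg (dilation r ν * δ) f (x + -(dilation r ν * δ / 2))

/-- The coefficient of a centred average in the Steklov average. -/
def steklovCoeff (𝕜 : Type*) [RCLike 𝕜] (r ν : ℕ) : 𝕜 :=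
  (-1) ^ (r + 1) * (((2 * r).choose r : ℕ) : 𝕜)⁻¹ * 2 * ((-1) ^ ν * (((2 * r).choose ν : ℕ) : 𝕜))

theorem dilation_bounds {r ν : ℕ} (hν : ν < r) : 1 / (r : ℝ) ≤ dilation r ν ∧ dilation r ν ≤ 1 := by
  have h1 : ((ν : ℝ) + 1) ≤ r := by exact_mod_cast hν
  have h2 : (0 : ℝ) ≤ ν := by positivity
  have h3 : (0 : ℝ) < r := by linarith
  rw [dilation]
  exact ⟨by gcongr; linarith, (div_le_one h3).2 (by linarith)⟩

/-- The substitution `t = δ u - δ / 2` turns the Steklov average into a combination of centred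
averages. -/
theorem steklov_eq_sum {δ : ℝ} (hδ : δ ≠ 0) (r : ℕ) (hf : LocInt f) :
    steklov δ r f =
      fun x => ∑ ν ∈ Finset.range r, steklovCoeff 𝕜 r ν * centredAvg δ r ν f x := by
  funext x
  have hI : ∫ t in (-(δ / 2))..(δ / 2), ∑ ν ∈ Finset.range r,
      (-1) ^ ν * (((2 * r).choose ν : ℕ) : 𝕜) * f (x + (((r : ℝ) - (ν : ℝ)) / (r : ℝ)) * t) =
      δ • ∑ ν ∈ Finset.range r, (-1) ^ ν * (((2 * r).choose ν : ℕ) : 𝕜) * centredAvg δ r ν f x := by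
    have h1 := intervalIntegral.smul_integral_comp_mul_sub (a := 0) (b := 1)
      (fun t => ∑ ν ∈ Finset.range r,
        (-1) ^ ν * (((2 * r).choose ν : ℕ) : 𝕜) * f (x + (((r : ℝ) - (ν : ℝ)) / (r : ℝ)) * t))
      δ (δ / 2)
    rw [show δ * 0 - δ / 2 = -(δ / 2) by ring, show δ * 1 - δ / 2 = δ / 2 by ring] at h1
    have e : ∀ (u : ℝ) (ν : ℕ), x + (((r : ℝ) - (ν : ℝ)) / (r : ℝ)) * (δ * u - δ / 2) =
        x + -(dilation r ν * δ / 2) + dilation r ν * δ * u := fun u ν => by rw [dilation]; ring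
    rw [← h1]
    simp only [e]
    rw [intervalIntegral.integral_finsetSum fun ν _ => (hf.comp_add_mul _ _).const_mul _]
    simp only [intervalIntegral.integral_const_mul]
    rfl
  rw [steklov, hI, RCLike.real_smul_eq_coe_mul, Finset.mul_sum, Finset.mul_sum]
  refine Finset.sum_congr rfl fun ν _ => ?_
  have hδ' : (δ : 𝕜) ≠ 0 := by exact_mod_cast hδ
  rw [steklovCoeff]
  push_cast
  field_simp

theorem centredAvg_sum {ι : Type*} {I : Finset ι} {F : ι → ℝ → 𝕜} (δ : ℝ) (r ν : ℕ) (c : ι → 𝕜)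
    (hF : ∀ i ∈ I, LocInt (F i)) :
    centredAvg δ r ν (fun x => ∑ i ∈ I, c i * F i x) =
      fun x => ∑ i ∈ I, c i * centredAvg δ r ν (F i) x := by
  funext x
  rw [centredAvg, avg_sum _ fun i hi => (hF i hi).const_mul (c i)]
  simp only [avg_const_mul, centredAvg]

theorem steklov_sum {ι : Type*} {I : Finset ι} {F : ι → ℝ → 𝕜} {δ : ℝ} (hδ : δ ≠ 0) (r : ℕ)
    (c : ι → 𝕜) (hF : ∀ i ∈ I, LocInt (F i)) :
    steklov δ r (fun x => ∑ i ∈ I, c i * F i x) = fun x => ∑ i ∈ I, c i * steklov δ r (F i) x := by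
  funext x
  rw [steklov_eq_sum hδ r (LocInt.sum fun i hi => (hF i hi).const_mul (c i))]
  simp only [centredAvg_sum δ r _ c hF, Finset.mul_sum]
  rw [Finset.sum_comm]
  refine Finset.sum_congr rfl fun i hi => ?_
  rw [steklov_eq_sum hδ r (hF i hi), Finset.mul_sum]
  exact Finset.sum_congr rfl fun ν _ => by ring

theorem steklov_sub {δ : ℝ} (hδ : δ ≠ 0) (r : ℕ) (hf : LocInt f) (hg : LocInt g) :
    steklov δ r (fun x => f x - g x) = fun x => steklov δ r f x - steklov δ r g x := by
  funext x
  rw [steklov_eq_sum hδ r (hf.sub hg), steklov_eq_sum hδ r hf, steklov_eq_sum hδ r hg,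
    ← Finset.sum_sub_distrib]
  refine Finset.sum_congr rfl fun ν _ => ?_
  rw [centredAvg, avg_sub _ hf hg, ← mul_sub]
  rfl

theorem MemLpT.centredAvg (hp : 1 ≤ p) (hf : MemLpT p f) (δ : ℝ) (r ν : ℕ) :
    MemLpT p (centredAvg δ r ν f) :=
  (avg_memLpT_and_normT_le hp hf _).1.shift hp _

theorem MemLpT.steklov (hp : 1 ≤ p) (hf : MemLpT p f) {δ : ℝ} (hδ : δ ≠ 0) (r : ℕ) :
    MemLpT p (steklov δ r f) := by
  rw [steklov_eq_sum hδ r (hf.locInt hp)]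
  exact MemLpT.sum fun ν _ => (hf.centredAvg hp δ r ν).const_mul _

theorem LocInt.centredAvg (hf : LocInt f) (δ : ℝ) (r ν : ℕ) : LocInt (centredAvg δ r ν f) :=
  (hf.avg _).shift _

theorem LocInt.steklov (hf : LocInt f) {δ : ℝ} (hδ : δ ≠ 0) (r : ℕ) : LocInt (steklov δ r f) := by
  rw [steklov_eq_sum hδ r hf]
  exact LocInt.sum fun ν _ => (hf.centredAvg δ r ν).const_mul _

theorem avg_steklov {δ : ℝ} (hδ : δ ≠ 0) (r : ℕ) (a : ℝ) (hf : LocInt f) :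
    avg a (steklov δ r f) = steklov δ r (avg a f) := by
  rw [steklov_eq_sum hδ r hf, steklov_eq_sum hδ r (hf.avg a),
    avg_sum a fun ν _ => (hf.centredAvg δ r ν).const_mul _]
  funext x
  refine Finset.sum_congr rfl fun ν _ => ?_
  have h : centredAvg δ r ν f =
      fun x => avg (dilation r ν * δ) f (x + -(dilation r ν * δ / 2)) := rfl
  rw [avg_const_mul, h, avg_shift, avg_comm hf, centredAvg]

theorem avg_iterate_steklov_sub {δ : ℝ} (hδ : δ ≠ 0) (r : ℕ) (a : ℝ) (k : ℕ) (hf : LocInt f) :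
    (avg a)^[k] (fun x => steklov δ r f x - f x) =
      fun x => steklov δ r ((avg a)^[k] f) x - (avg a)^[k] f x := by
  induction k with
  | zero => rfl
  | succ k ih =>
    have hk := hf.avg_iterate a k
    rw [Function.iterate_succ_apply', ih, avg_sub a (hk.steklov hδ r) hk, avg_steklov hδ r a hk,
      ← Function.iterate_succ_apply' (avg a)]

theorem dilation_reflect {r ν : ℕ} (hν : ν ≤ 2 * r) :
    dilation r (2 * r - ν) = -dilation r ν := by
  rw [dilation, dilation, Nat.cast_sub hν]
  push_cast
  ring

/-- A segment can be traversed from either end. -/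
theorem avg_neg (a : ℝ) (f : ℝ → 𝕜) (x : ℝ) : avg (-a) f (x + a) = avg a f x := by
  have := intervalIntegral.integral_comp_sub_left (fun u => f (x + a * u)) (1 : ℝ) (a := 0) (b := 1)
  simp only [sub_self, sub_zero] at this
  rw [avg, avg, ← this]
  congr 1
  funext u
  ring_nf

theorem centredAvg_reflect {r ν : ℕ} (hν : ν ≤ 2 * r) (δ : ℝ) (f : ℝ → 𝕜) (x : ℝ) :
    centredAvg δ r (2 * r - ν) f x = centredAvg δ r ν f x := by
  rw [centredAvg, dilation_reflect hν, centredAvg, ← avg_neg]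
  ring_nf

theorem neg_one_pow_two_mul_sub {r ν : ℕ} (hν : ν ≤ 2 * r) :
    (-1 : 𝕜) ^ (2 * r - ν) = (-1) ^ ν := by
  obtain ⟨m, hm⟩ := Nat.exists_eq_add_of_le hν
  rw [hm, Nat.add_sub_cancel_left]
  have h : (-1 : 𝕜) ^ ν * (-1) ^ m = 1 := by rw [← pow_add, ← hm, pow_mul]; simp
  have h2 : (-1 : 𝕜) ^ ν * (-1) ^ ν = 1 := by rw [← pow_add, ← two_mul, pow_mul]; simp
  linear_combination (-1 : 𝕜) ^ ν * h - (-1 : 𝕜) ^ m * h2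

/-- The terms `ν` and `2 r - ν` of the central difference of order `2 r` have the same average, and
the term `ν = r` is a multiple of `f`. Hence `f_δ - f` is an average of central differences. -/
theorem steklov_sub_eq_sum {δ : ℝ} (hδ : δ ≠ 0) {r : ℕ} (hr : 1 ≤ r) (hf : LocInt f) (x : ℝ) :
    steklov δ r f x - f x = (-1) ^ (r + 1) * (((2 * r).choose r : ℕ) : 𝕜)⁻¹ *
      ∑ ν ∈ Finset.range (2 * r + 1),
        (-1) ^ ν * (((2 * r).choose ν : ℕ) : 𝕜) * centredAvg δ r ν f x := by
  set T : ℕ → 𝕜 := fun ν => (-1) ^ ν * (((2 * r).choose ν : ℕ) : 𝕜) * centredAvg δ r ν f x with hT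
  have hrefl : ∀ ν, ν ≤ 2 * r → T (2 * r - ν) = T ν := fun ν hν => by
    simp only [hT]
    rw [Nat.choose_symm hν, neg_one_pow_two_mul_sub hν, centredAvg_reflect hν]
  have hmid : T r = (-1) ^ r * (((2 * r).choose r : ℕ) : 𝕜) * f x := by
    simp [hT, centredAvg, dilation, avg_zero]
  have hsum : ∑ ν ∈ Finset.range (2 * r + 1), T ν = 2 * ∑ ν ∈ Finset.range r, T ν + T r := by
    rw [show 2 * r + 1 = r + 1 + r by ring, Finset.sum_range_add, Finset.sum_range_succ,
      ← Finset.sum_range_reflect (fun y => T (r + 1 + y))]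
    have : ∑ j ∈ Finset.range r, T (r + 1 + (r - 1 - j)) = ∑ j ∈ Finset.range r, T j :=
      Finset.sum_congr rfl fun j hj => by
        have := Finset.mem_range.1 hj
        rw [← hrefl j (by omega)]
        congr 1
        omega
    rw [this]
    ring
  have hC : (((2 * r).choose r : ℕ) : 𝕜) ≠ 0 := by
    exact_mod_cast (Nat.choose_pos (by omega)).ne'
  have hsq : (-1 : 𝕜) ^ r * (-1) ^ r = 1 := by rw [← pow_add, ← two_mul, pow_mul]; simp
  have hst : steklov δ r f x = (-1) ^ (r + 1) * (((2 * r).choose r : ℕ) : 𝕜)⁻¹ * 2 *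
      ∑ ν ∈ Finset.range r, T ν := by
    rw [steklov_eq_sum hδ r hf, Finset.mul_sum]
    refine Finset.sum_congr rfl fun ν _ => ?_
    rw [steklovCoeff, hT]
    ring
  rw [hsum, hmid, hst, pow_succ]
  field_simp
  linear_combination (((2 * r).choose r : ℕ) : 𝕜) * f x * hsq

/-- The central difference of order `2 r` is even in its step, so that only positive steps need be
considered. -/
theorem central_sum_even (r : ℕ) (t : ℝ) (f : ℝ → 𝕜) (x : ℝ) :
    ∑ ν ∈ Finset.range (2 * r + 1),
        (-1) ^ ν * (((2 * r).choose ν : ℕ) : 𝕜) * f (x + dilation r ν * -t) =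
      ∑ ν ∈ Finset.range (2 * r + 1),
        (-1) ^ ν * (((2 * r).choose ν : ℕ) : 𝕜) * f (x + dilation r ν * t) := by
  rw [← Finset.sum_range_reflect]
  refine Finset.sum_congr rfl fun ν hν => ?_
  have hν' : ν ≤ 2 * r := Nat.lt_succ_iff.1 (Finset.mem_range.1 hν)
  rw [Nat.add_sub_cancel, dilation_reflect hν', Nat.choose_symm hν',
    neg_one_pow_two_mul_sub hν', neg_mul_neg]

theorem central_sum_eq_diff {r : ℕ} (hr : 1 ≤ r) (t : ℝ) (f : ℝ → 𝕜) (x : ℝ) :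
    ∑ ν ∈ Finset.range (2 * r + 1),
        (-1) ^ ν * (((2 * r).choose ν : ℕ) : 𝕜) * f (x + dilation r ν * t) =
      diff (2 * r) (t / r) f (x + -t) := by
  have hr0 : (r : ℝ) ≠ 0 := by positivity
  rw [diff]
  refine Finset.sum_congr rfl fun ν _ => ?_
  rw [mul_comm ((-1 : 𝕜) ^ ν), dilation]
  congr 2
  push_cast
  field_simp
  ring

/-- By Minkowski's integral inequality, `f_δ - f` inherits the bound for the central differences of
order `2 r`, and differences of order `2 r` are dominated by those of order `s ≤ 2 r`. -/
theorem normT_steklov_sub_le (hp : 1 ≤ p) (hf : MemLpT p f) {r s : ℕ} (hr : 1 ≤ r) (hs : 1 ≤ s)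
    (hsr : s ≤ 2 * r) {δ η : ℝ} (hδ : 0 < δ) (hη : δ ≤ η) :
    normT p (fun x => steklov δ r f x - f x) ≤ 2 ^ (2 * r - s) * modulus p s f η := by
  have hr1 : (1 : ℝ) ≤ r := by exact_mod_cast hr
  have hM : 0 ≤ 2 ^ (2 * r - s) * modulus p s f η :=
    mul_nonneg (by positivity) (modulus_nonneg _ _ _ _)
  have hC : (1 : ℝ) ≤ ((2 * r).choose r : ℕ) := by
    exact_mod_cast Nat.choose_pos (by omega : r ≤ 2 * r)
  have hcent : ∀ t : ℝ, |t| < η → normT p (fun x => ∑ ν ∈ Finset.range (2 * r + 1),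
      (-1) ^ ν * (((2 * r).choose ν : ℕ) : 𝕜) * f (x + dilation r ν * t)) ≤
        2 ^ (2 * r - s) * modulus p s f η := by
    intro t ht
    have habs : (fun x => ∑ ν ∈ Finset.range (2 * r + 1),
        (-1) ^ ν * (((2 * r).choose ν : ℕ) : 𝕜) * f (x + dilation r ν * t)) =
        fun x => diff (2 * r) (|t| / r) f (x + -|t|) := by
      funext x
      rw [← central_sum_eq_diff hr]
      rcases abs_choice t with h | h
      · rw [h]
      · rw [h, central_sum_even]
    rw [habs, normT_shift hp (hf.diff hp _ _).1]
    refine normT_diff_le_of_le hp hf hs hsr (by positivity) (lt_of_le_of_lt ?_ ht)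
    exact div_le_self (abs_nonneg t) hr1
  have h := (sum_avg_memLpT_and_normT_le hp (Finset.range (2 * r + 1))
    (fun ν x => (-1) ^ ν * (((2 * r).choose ν : ℕ) : 𝕜) * f x) (fun ν _ => hf.const_mul _)
    (fun ν => -(dilation r ν * δ / 2)) (fun ν => dilation r ν * δ) hM (fun u hu => by
      have e : ∀ (x : ℝ) (ν : ℕ), x + -(dilation r ν * δ / 2) + dilation r ν * δ * u =
          x + dilation r ν * (δ * u - δ / 2) := fun x ν => by ring
      simp only [e]
      refine hcent _ (abs_lt.2 ⟨?_, ?_⟩) <;>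
        linarith [mul_pos hδ hu.1, mul_lt_of_lt_one_right hδ hu.2])).2
  simp only [avg_const_mul] at h
  simp only [steklov_sub_eq_sum hδ.ne' hr (hf.locInt hp)]
  rw [normT_const_mul hp, norm_mul, norm_pow, norm_neg, norm_one, one_pow, one_mul, norm_inv,
    RCLike.norm_natCast]
  refine le_trans (mul_le_of_le_one_left (normT_nonneg _ _) (inv_le_one_of_one_le₀ hC)) ?_
  exact h

/-- The constant in the bound for the Steklov average from `L_p` to the discrete norm. -/
def steklovConst (𝕜 : Type*) [RCLike 𝕜] (p : ℝ) (r : ℕ) (γ : ℝ) : ℝ :=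
  (∑ ν ∈ Finset.range r, ‖steklovCoeff 𝕜 r ν‖) * (r / γ) ^ (1 / p)

/-- Steklov averages with `δ = γ / n` are bounded from `L_p` to the discrete norm, being
combinations of averages over segments of length between `δ / r` and `δ`. -/
theorem discNorm_steklov_le (hp : 1 ≤ p) (hf : MemLpT p f) {γ : ℝ} (hγ : 0 < γ) {x : ℕ → ℕ → ℝ}
    (hx : IsNodeSystem γ x) {n : ℕ} (hn : 1 ≤ n) (r : ℕ) :
    discNorm p n (x n) (steklov (γ / n) r f) ≤ steklovConst 𝕜 p r γ * normT p f := by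
  have hn0 : (0 : ℝ) < n := by exact_mod_cast hn
  have hδ : 0 < γ / n := by positivity
  rw [steklov_eq_sum hδ.ne' r (hf.locInt hp), steklovConst, mul_assoc, Finset.sum_mul]
  refine (discNorm_sum_le hp n _ _ _).trans (Finset.sum_le_sum fun ν hν => ?_)
  have hνr := Finset.mem_range.1 hν
  obtain ⟨h1, h2⟩ := dilation_bounds hνr
  have hr0 : (0 : ℝ) < r := by exact_mod_cast (by omega : 0 < r)
  have hc : 0 < dilation r ν := lt_of_lt_of_le (by positivity) h1
  rw [discNorm_const_mul hp]
  gcongr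
  refine (discNorm_avg_le hp hf hx hn (mul_pos hc hδ) (mul_le_of_le_one_left hδ.le h2) _).trans ?_
  refine mul_le_mul_of_nonneg_right (Real.rpow_le_rpow (by positivity) ?_ (by positivity))
    (normT_nonneg p f)
  calc 1 / (n * (dilation r ν * (γ / n))) = 1 / (dilation r ν * γ) := by field_simp
    _ ≤ 1 / (1 / r * γ) := by gcongr
    _ = r / γ := by field_simp

/-- The Steklov error of the smooth approximation in the discrete norm. Steklov averages commute
with the averages defining `smoothing`, so that the error is a combination of averages of
`f_δ - f`, and the last of these averages maps `L_p` to the discrete norm. -/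
theorem discNorm_steklov_smoothing_sub_le (hp : 1 ≤ p) (hf : MemLpT p f) {γ : ℝ} (hγ : 0 < γ)
    {x : ℕ → ℕ → ℝ} (hx : IsNodeSystem γ x) {n : ℕ} (hn : 1 ≤ n) (r : ℕ) {s : ℕ} (hs : 1 ≤ s)
    {h : ℝ} (hh : 0 < h) (hsh : s * h ≤ γ / n) :
    discNorm p n (x n)
        (fun t => steklov (γ / n) r (smoothing s h f) t - smoothing s h f t) ≤
      2 ^ s * ((1 / (n * h)) ^ (1 / p) * normT p (fun t => steklov (γ / n) r f t - f t)) := by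
  have hn0 : (0 : ℝ) < n := by exact_mod_cast hn
  have hδ : 0 < γ / n := by positivity
  have hfl := hf.locInt hp
  have hE : MemLpT p (fun t => steklov (γ / n) r f t - f t) := (hf.steklov hp hδ.ne' r).sub hf
  have heq : (fun t => steklov (γ / n) r (smoothing s h f) t - smoothing s h f t) =
      fun t => ∑ j ∈ Finset.Icc 1 s, (-1) ^ (j + 1) * (s.choose j : 𝕜) *
        (avg (j * h))^[s] (fun t => steklov (γ / n) r f t - f t) t := by
    have h1 : steklov (γ / n) r (smoothing s h f) = fun t => ∑ j ∈ Finset.Icc 1 s,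
        (-1) ^ (j + 1) * (s.choose j : 𝕜) * steklov (γ / n) r ((avg (j * h))^[s] f) t :=
      steklov_sum hδ.ne' r _ fun j _ => hfl.avg_iterate _ s
    funext t
    rw [h1, smoothing, ← Finset.sum_sub_distrib]
    refine Finset.sum_congr rfl fun j _ => ?_
    rw [avg_iterate_steklov_sub hδ.ne' r _ s hfl]
    ring
  rw [heq]
  refine (discNorm_sum_le hp n _ _ _).trans ?_
  calc _ ≤ ∑ j ∈ Finset.Icc 1 s, ‖(-1) ^ (j + 1) * (s.choose j : 𝕜)‖ *
        ((1 / (n * h)) ^ (1 / p) * normT p (fun t => steklov (γ / n) r f t - f t)) := by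
        refine Finset.sum_le_sum fun j hj => ?_
        have hj1 : (1 : ℝ) ≤ j := by exact_mod_cast (Finset.mem_Icc.1 hj).1
        have hjs : (j : ℝ) ≤ s := by exact_mod_cast (Finset.mem_Icc.1 hj).2
        have hjh : h ≤ j * h := le_mul_of_one_le_left hh.le hj1
        have hjh' : j * h ≤ γ / n := le_trans (by gcongr) hsh
        obtain ⟨k, rfl⟩ := Nat.exists_eq_add_of_le' hs
        rw [discNorm_const_mul hp, Function.iterate_succ_apply']
        gcongr
        have h1 := discNorm_avg_le hp (hE.avg_iterate hp (j * h) k) hx hn (by positivity) hjh' 0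
        simp only [add_zero] at h1
        refine h1.trans ?_
        gcongr
        · exact normT_nonneg _ _
        · exact normT_avg_iterate_le hp hE _ _
    _ ≤ _ := by
        rw [← Finset.sum_mul]
        have := normT_nonneg p (fun t => steklov (γ / n) r f t - f t)
        gcongr
        exact sum_norm_choose_le s _ (Icc_one_subset_range s) _

end Steklov

/-! ### Sampling operators -/

section Sampling

variable {𝕜 : Type*} [RCLike 𝕜] {p : ℝ} {f g : ℝ → 𝕜} {x : ℕ → ℕ → ℝ} {φ : ℕ → ℕ → ℝ → 𝕜}

theorem sampling_sub (x : ℕ → ℕ → ℝ) (φ : ℕ → ℕ → ℝ → 𝕜) (n : ℕ) (f g : ℝ → 𝕜) (t : ℝ) :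
    sampling x φ n (fun t => f t - g t) t = sampling x φ n f t - sampling x φ n g t := by
  simp only [sampling, sub_mul, Finset.sum_sub_distrib]

theorem memLpT_sampling {n : ℕ} (hφ : ∀ k : ℕ, 1 ≤ k → k ≤ n → MemLpT p (φ n k)) (f : ℝ → 𝕜) :
    MemLpT p (sampling x φ n f) :=
  MemLpT.sum fun k hk => (hφ k (Finset.mem_Icc.1 hk).1 (Finset.mem_Icc.1 hk).2).const_mul _

theorem discNorm_sub_comm (p : ℝ) (n : ℕ) (y : ℕ → ℝ) (f g : ℝ → 𝕜) :
    discNorm p n y (fun t => f t - g t) = discNorm p n y (fun t => g t - f t) := by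
  simp only [discNorm, norm_sub_rev]

/-- The constant function `1` shows that a lower sampling constant cannot exceed an upper one. -/
theorem lower_le_upper {K₁ K₂ : ℝ} (h₁ : UpperSampling p K₁ x φ)
    (h₂ : LowerSampling p K₂ x φ) : K₂ ≤ K₁ := by
  have h := (h₂ (fun _ => 1) 1 memLpT_one le_rfl).trans (h₁ (fun _ => 1) 1 memLpT_one le_rfl)
  simpa [discNorm] using h

/-- Passing from `f` to an approximation `g` changes the Steklov error at the nodes by the Steklov
error of `g`, the Steklov average of `f - g`, and `f - g` itself. -/
theorem discNorm_sub_le_add (hp : 1 ≤ p) (hf : LocInt f) (hg : LocInt g) {δ : ℝ} (hδ : δ ≠ 0)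
    (r n : ℕ) (y : ℕ → ℝ) :
    discNorm p n y (fun t => f t - g t) ≤ discNorm p n y (fun t => steklov δ r f t - f t) +
        (discNorm p n y (steklov δ r (fun t => f t - g t)) +
          discNorm p n y (fun t => steklov δ r g t - g t)) ∧
      discNorm p n y (fun t => steklov δ r f t - f t) ≤ discNorm p n y (fun t => f t - g t) +
        (discNorm p n y (steklov δ r (fun t => f t - g t)) +
          discNorm p n y (fun t => steklov δ r g t - g t)) := by
  have hs : ∀ t, steklov δ r (fun t => f t - g t) t = steklov δ r f t - steklov δ r g t :=
    congrFun (steklov_sub hδ r hf hg)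
  constructor
  · rw [discNorm_sub_comm p n y (steklov δ r f) f]
    refine le_trans (le_of_eq ?_) ((discNorm_add_le hp n y (fun t => f t - steklov δ r f t)
      (fun t => steklov δ r (fun t => f t - g t) t + (steklov δ r g t - g t))).trans
      (add_le_add le_rfl (discNorm_add_le hp n y _ _)))
    congr 1
    funext t
    rw [hs]
    ring
  · rw [discNorm_sub_comm p n y f g]
    refine le_trans (le_of_eq ?_) ((discNorm_add_le hp n y (fun t => g t - f t)
      (fun t => steklov δ r (fun t => f t - g t) t + (steklov δ r g t - g t))).trans
      (add_le_add le_rfl (discNorm_add_le hp n y _ _)))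
    congr 1
    funext t
    rw [hs]
    ring

/-- The constant in the bound for the derivative of the smooth approximation. -/
def derivConst (s : ℕ) (γ : ℝ) : ℝ := 2 ^ s * (2 * s / γ) ^ s

/-- The constant in the bound, in the discrete norm, for the Steklov error of the smooth
approximation and the Steklov average of its distance from `f`. -/
def nodeConst (𝕜 : Type*) [RCLike 𝕜] (p : ℝ) (r s : ℕ) (γ : ℝ) : ℝ :=
  steklovConst 𝕜 p r γ + 2 ^ s * ((2 * s / γ) ^ (1 / p) * 2 ^ (2 * r - s))

/-- Every `f` in `L_p` has a smooth approximation at the scale `1 / n`, all of whose errors are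
controlled by the modulus of smoothness. -/
theorem exists_smooth_approximation (hp : 1 ≤ p) {r s : ℕ} (hr : 1 ≤ r) (hs : 1 ≤ s)
    (hsr : s ≤ 2 * r) {γ : ℝ} (hγ : 0 < γ) (hγ1 : γ ≤ 1) (hx : IsNodeSystem γ x)
    (hf : MemLpT p f) {n : ℕ} (hn : 1 ≤ n) :
    ∃ g : ℝ → 𝕜, MemLpT p g ∧ MemSobolevT p s g ∧
      normT p (fun t => f t - g t) ≤ modulus p s f (1 / n) ∧
      normT p (iteratedDeriv s g) ≤ derivConst s γ * (n : ℝ) ^ s * modulus p s f (1 / n) ∧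
      discNorm p n (x n) (steklov (γ / n) r (fun t => f t - g t)) +
        discNorm p n (x n) (fun t => steklov (γ / n) r g t - g t) ≤
          nodeConst 𝕜 p r s γ * modulus p s f (1 / n) := by
  have hn0 : (0 : ℝ) < n := by exact_mod_cast hn
  have hs0 : (0 : ℝ) < s := by exact_mod_cast hs
  have hM := modulus_nonneg p s f (1 / n)
  -- The factor 2 makes the largest step `s * h` strictly less than `1 / n`.
  set h : ℝ := γ / (2 * s * n) with hh
  have h0 : 0 < h := by positivity
  have hinv : h⁻¹ = 2 * s / γ * n := by rw [hh, inv_div]; ring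
  have hnh : 1 / (n * h) = 2 * s / γ := by rw [hh]; field_simp
  have hsh : s * h = γ / n / 2 := by rw [hh]; field_simp
  have hδ : 0 < γ / n := by positivity
  have hδ1 : γ / n ≤ 1 / n := by gcongr
  have hsob := smoothing_memSobolevT hp hf hs h0 (δ := 1 / n) (by linarith)
  have hdist := normT_sub_smoothing_le hp hf hs h0 (δ := 1 / n) (by linarith)
  refine ⟨smoothing s h f, hf.smoothing hp s h, hsob.1, hdist, ?_, ?_⟩
  · refine hsob.2.trans (le_of_eq ?_)
    rw [derivConst, hinv, mul_pow]
    ring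
  · have h1 := discNorm_steklov_le hp (hf.sub (hf.smoothing hp s h)) hγ hx hn r
    have h2 := discNorm_steklov_smoothing_sub_le hp hf hγ hx hn r hs h0 (by linarith)
    have h3 := normT_steklov_sub_le hp hf hr hs hsr hδ hδ1
    rw [hnh] at h2
    rw [nodeConst, add_mul]
    refine add_le_add (h1.trans ?_) (h2.trans ?_)
    · have : 0 ≤ steklovConst 𝕜 p r γ := by unfold steklovConst; positivity
      gcongr
    · calc _ ≤ 2 ^ s * ((2 * s / γ) ^ (1 / p) * (2 ^ (2 * r - s) * modulus p s f (1 / n))) := by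
            gcongr
        _ = _ := by ring

end Sampling

end

end SamplingLp

theorem mainTheorem1 {𝕜 : Type*} [RCLike 𝕜] (p : ℝ) (hp : 1 ≤ p) (r s : ℕ) (hr : 1 ≤ r)
    (hs : 1 ≤ s) (hsr : s ≤ 2 * r) (γ K₁ K₃ : ℝ) (hγ : 0 < γ) (hγ1 : γ ≤ 1) (hK₁ : 0 < K₁)
    (hK₃ : 0 < K₃) :
    ∃ C₁ : ℝ, 0 < C₁ ∧ ∃ C₂ : ℝ, 0 < C₂ ∧
      ∀ (x : ℕ → ℕ → ℝ) (φ : ℕ → ℕ → ℝ → 𝕜),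
        SamplingLp.IsNodeSystem γ x →
        (∀ n k : ℕ, 1 ≤ k → k ≤ n → SamplingLp.MemLpT p (φ n k)) →
        SamplingLp.UpperSampling p K₁ x φ →
        SamplingLp.JacksonSampling p s K₃ x φ →
        (∀ (f : ℝ → 𝕜) (n : ℕ), SamplingLp.MemLpT p f → 1 ≤ n →
          SamplingLp.normT p (fun t => f t - SamplingLp.sampling x φ n f t) ≤
            K₁ * SamplingLp.discNorm p n (x n)
                (fun t => SamplingLp.steklov (γ / (n : ℝ)) r f t - f t) +
              C₁ * SamplingLp.modulus p s f (1 / (n : ℝ))) ∧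
        (∀ K₂ : ℝ, 0 < K₂ → SamplingLp.LowerSampling p K₂ x φ →
          ∀ (f : ℝ → 𝕜) (n : ℕ), SamplingLp.MemLpT p f → 1 ≤ n →
            K₂ * SamplingLp.discNorm p n (x n)
                (fun t => SamplingLp.steklov (γ / (n : ℝ)) r f t - f t) -
              C₂ * SamplingLp.modulus p s f (1 / (n : ℝ)) ≤
            SamplingLp.normT p (fun t => f t - SamplingLp.sampling x φ n f t)) := by
  set C : ℝ := 1 + K₃ * SamplingLp.derivConst s γ + K₁ * SamplingLp.nodeConst 𝕜 p r s γ with hC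
  have hD : 0 ≤ SamplingLp.derivConst s γ := by unfold SamplingLp.derivConst; positivity
  have hN : 0 ≤ SamplingLp.nodeConst 𝕜 p r s γ := by
    unfold SamplingLp.nodeConst SamplingLp.steklovConst; positivity
  have hC0 : 0 < C := by positivity
  refine ⟨C, hC0, C, hC0, fun x φ hx hφ hU hJ => ?_⟩
  -- For the smooth approximation `g`, the Jackson bound becomes a multiple of the modulus.
  have key : ∀ (f : ℝ → 𝕜) (n : ℕ), SamplingLp.MemLpT p f → 1 ≤ n → ∃ g : ℝ → 𝕜,
      SamplingLp.MemLpT p g ∧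
      SamplingLp.normT p (fun t => f t - g t) +
          SamplingLp.normT p (fun t => g t - SamplingLp.sampling x φ n g t) ≤
        (1 + K₃ * SamplingLp.derivConst s γ) * SamplingLp.modulus p s f (1 / (n : ℝ)) ∧
      SamplingLp.discNorm p n (x n)
          (SamplingLp.steklov (γ / (n : ℝ)) r (fun t => f t - g t)) +
        SamplingLp.discNorm p n (x n) (fun t => SamplingLp.steklov (γ / (n : ℝ)) r g t - g t) ≤
          SamplingLp.nodeConst 𝕜 p r s γ * SamplingLp.modulus p s f (1 / (n : ℝ)) := by
    intro f n hf hn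
    have hn0 : (0 : ℝ) < n := by exact_mod_cast hn
    obtain ⟨g, hg, hgW, hfg, hgd, hnode⟩ :=
      SamplingLp.exists_smooth_approximation (x := x) hp hr hs hsr hγ hγ1 hx hf hn
    refine ⟨g, hg, ?_, hnode⟩
    have h1 := (hJ g n hgW hn).trans (mul_le_mul_of_nonneg_left hgd (by positivity))
    have h2 : K₃ * ((n : ℝ) ^ s)⁻¹ * (SamplingLp.derivConst s γ * (n : ℝ) ^ s *
        SamplingLp.modulus p s f (1 / (n : ℝ))) =
        K₃ * SamplingLp.derivConst s γ * SamplingLp.modulus p s f (1 / (n : ℝ)) := by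
      field_simp
    linarith
  refine ⟨fun f n hf hn => ?_, fun K₂ hK₂ hL f n hf hn => ?_⟩
  all_goals
    have hδ : γ / (n : ℝ) ≠ 0 := by positivity
    obtain ⟨g, hg, hA, hB⟩ := key f n hf hn
    have hM := SamplingLp.modulus_nonneg p s f (1 / (n : ℝ))
    have hGf := SamplingLp.memLpT_sampling (x := x) (hφ n) f
    have hGg := SamplingLp.memLpT_sampling (x := x) (hφ n) g
    obtain ⟨hd₁, hd₂⟩ :=
      SamplingLp.discNorm_sub_le_add hp (hf.locInt hp) (hg.locInt hp) hδ r n (x n)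
    have hS : SamplingLp.sampling x φ n (fun t => f t - g t) =
        fun t => SamplingLp.sampling x φ n f t - SamplingLp.sampling x φ n g t :=
      funext (SamplingLp.sampling_sub x φ n f g)
    have hT := SamplingLp.normT_add_le hp (hf.sub hg) (hg.sub hGg)
  · have hu := hU _ n (hf.sub hg) hn
    have h1 := SamplingLp.normT_sub_le hp ((hf.sub hg).add (hg.sub hGg)) (hGf.sub hGg)
    have h2 : (fun t => f t - g t + (g t - SamplingLp.sampling x φ n g t) -
        (SamplingLp.sampling x φ n f t - SamplingLp.sampling x φ n g t)) =
        fun t => f t - SamplingLp.sampling x φ n f t := by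
      funext t
      ring
    rw [h2, ← hS] at h1
    have h3 := mul_le_mul_of_nonneg_left (hd₁.trans (add_le_add le_rfl hB)) hK₁.le
    rw [hC]
    linarith
  · have hl := hL _ n (hf.sub hg) hn
    have h1 := SamplingLp.normT_sub_le hp ((hf.sub hg).add (hg.sub hGg)) (hf.sub hGf)
    have h2 : (fun t => f t - g t + (g t - SamplingLp.sampling x φ n g t) -
        (f t - SamplingLp.sampling x φ n f t)) =
        fun t => SamplingLp.sampling x φ n f t - SamplingLp.sampling x φ n g t := by
      funext t
      ring
    rw [h2, ← hS] at h1
    have h3 := mul_le_mul_of_nonneg_left (hd₂.trans (add_le_add le_rfl hB)) hK₂.le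
    have h4 := mul_le_mul_of_nonneg_right (SamplingLp.lower_le_upper hU hL) (mul_nonneg hN hM)
    rw [hC]
    linarith
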